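/- Consider a group-server queue: customers arrive in a Poisson stream of rate $\lambda>0$ to a station with infinite waiting room and $K\ge 1$ groups of parallel servers; group $k$ has $M_k\ge 1$ servers, each of which, when on, serves at exponential rate $\mu_k>0$ and costs $c_k$ per unit of time, and $(\mu_k,c_k)\ne(\mu_l,c_l)$ for $k\neq l$. The state $n$ is the number of customers in the system. A (stationary, efficient) policy $d$ chooses in each state $n\in\mathbb N$ numbers $d(n,k)\in\{0,\dots,M_k\}$ of working servers with $\sum_k d(n,k)\le n$, so that the number $n_t$ of customers at time $t$ is a birth–death process with birth rate $\lambda$ and death rate $\sum_k d(n,k)\mu_k$ in state $n$. Its long-run average cost is $$\eta^d=\lim_{T\to\infty}\mathbb E\Big\{\frac1T\int_0^T\Big(h(n_t)+\sum_k d(n_t,k)c_k\Big)\,dt\Big\},$$ where the holding cost $h:\mathbb N\to\mathbb R$ is increasing (not necessarily strictly), convex, and $h(n)\to\infty$ as $n\to\infty$. A policy is optimal if $\eta^d$ is finite (the limit existing with the same value for every initial state) and minimal among all efficient policies. Assume scale economies: $\frac{c_1}{\mu_1}\le\dots\le\frac{c_K}{\mu_K}$ and $\mu_1\ge\dots\ge\mu_K$.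 A vector $\theta=(\theta_1,\dots,\theta_K)$ of positive integers with $\theta_1\le\dots\le\theta_K$ determines the threshold policy given recursively in $k$ by $d(n,k)=\min\{M_k,\;n-\sum_{l<k}d(n,l)\}$ if $n\ge\theta_k$, and $d(n,k)=0$ if $n<\theta_k$; it is an optimal threshold vector if the average cost of this policy is finite and minimal among all such vectors. Then the optimal threshold of group 1 (the most efficient group) is always $\theta_1^*=1$, that is, group 1 is used whenever any customer is present. Precisely: 1. every optimal threshold vector $\theta^*$ has $\theta_1^*=1$; 2. if $d^*$ is an optimal policy, $\eta^*$ its average cost, $g^*$ a performance potential of it (a solution of the Poisson equation $h(n)+\sum_k d^*(n,k)c_k-\eta^*+\lambda\,(g^*(n+1)-g^*(n))+\sum_k d^*(n,k)\mu_k\,(g^*(n-1)-g^*(n))=0$ for all $n\ge0$, the last term being absent for $n=0$), and $G^*(n)=g^*(n)-g^*(n-1)$ for $n\ge1$, then $\min\{n\ge1: G^*(n)>c_1/\mu_1\}=1$; 3. every optimal policy $d^*$ satisfies $d^*(n,1)=\min\{M_1,n\}$ for all $n\ge1$. -/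

import Mathlib

open Filter Topology

noncomputable section

/-- The data of a group-server queue with `K` groups of parallel servers. Group `k` consists of
`M k` servers; each of them, while working, serves at the exponential rate `mu k` and costs `c k`
per unit of time. Customers arrive in a Poisson stream of rate `lam`, and `h n` is the holding
cost per unit of time while `n` customers are present. -/
structure GroupQueue (K : ℕ) where
  lam : ℝ
  M : Fin K → ℕ
  mu : Fin K → ℝ
  c : Fin K → ℝ
  h : ℕ → ℝ

namespace GroupQueue

variable {K : ℕ}

/-- Standing assumptions of the model: positive rates, nonempty groups, servers of different
groups are not identical, and the holding cost is (weakly) increasing, convex, and tends to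
infinity. -/
structure Standing (Q : GroupQueue K) : Prop where
  lam_pos : 0 < Q.lam
  mu_pos : ∀ k, 0 < Q.mu k
  M_pos : ∀ k, 1 ≤ Q.M k
  heterogeneous : Function.Injective fun k => (Q.mu k, Q.c k)
  h_mono : Monotone Q.h
  h_convex : ∀ n, Q.h (n + 1) - Q.h n ≤ Q.h (n + 2) - Q.h (n + 1)
  h_tendsto : Tendsto Q.h atTop atTop

/-- Scale economies: the groups are numbered in ascending order of `c / mu` (so the first group is
the most efficient one), and in this order the service rates are decreasing. -/
structure ScaleEconomies (Q : GroupQueue K) : Prop where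
  ratio_mono : Monotone fun k => Q.c k / Q.mu k
  mu_anti : Antitone Q.mu

/-- A stationary scheduling policy: `d n k` is the number of working servers of group `k` while
`n` customers are in the system. -/
abbrev Policy (K : ℕ) : Type := ℕ → Fin K → ℕ

/-- The efficient policies: in every state `n` at most `M k` servers of group `k` work, and at
most `n` servers work in total. -/
def efficientPolicies (Q : GroupQueue K) : Set (Policy K) :=
  {d | ∀ n, (∀ k, d n k ≤ Q.M k) ∧ ∑ k, d n k ≤ n}

/-- The total service rate of the action `m`. -/
def serviceRate (Q : GroupQueue K) (m : Fin K → ℕ) : ℝ := ∑ k, (m k : ℝ) * Q.mu k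

/-- The total cost rate `f(n, m)`: holding cost plus operating cost. -/
def cost (Q : GroupQueue K) (n : ℕ) (m : Fin K → ℕ) : ℝ := Q.h n + ∑ k, (m k : ℝ) * Q.c k

/-- The infinitesimal generator of the birth-death process `n_t` (number of customers) under the
policy `d`, acting on functions of the state: births at rate `lam`, deaths at rate
`serviceRate (d n)`. In state `0` the second term is zero. -/
def gen (Q : GroupQueue K) (d : Policy K) : Module.End ℝ (ℕ → ℝ) where
  toFun g := fun n => Q.lam * (g (n + 1) - g n) + Q.serviceRate (d n) * (g (n - 1) - g n)
  map_add' g g' := by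
    funext n
    simp only [Pi.add_apply]
    ring
  map_smul' r g := by
    funext n
    simp only [Pi.smul_apply, smul_eq_mul, RingHom.id_apply]
    ring

/-- The transition probability `P(n_t = j | n_0 = i)` under the policy `d`, that is, the
`(i, j)` entry of `exp (t B)`, where `B` is the generator (whose entries are bounded). -/
def transProb (Q : GroupQueue K) (d : Policy K) (t : ℝ) (i j : ℕ) : ℝ :=
  ∑' r : ℕ, t ^ r / (r.factorial : ℝ) * ((Q.gen d ^ r) (Pi.single j 1)) i

/-- The expected cost rate `E[f(n_t, d(n_t)) | n_0 = i]` at time `t`. -/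
def expCost (Q : GroupQueue K) (d : Policy K) (i : ℕ) (t : ℝ) : ℝ :=
  ∑' j, Q.transProb d t i j * Q.cost j (d j)

/-- The policy `d` has the finite long-run average cost `a`: whatever the initial state `i`, the
expected costs are finite and `(1 / T) E[∫₀ᵀ f(n_t, d(n_t)) dt | n_0 = i]` tends to `a`. -/
def HasAverageCost (Q : GroupQueue K) (d : Policy K) (a : ℝ) : Prop :=
  ∀ i : ℕ,
    (∀ t : ℝ, 0 ≤ t → Summable fun j => Q.transProb d t i j * Q.cost j (d j)) ∧
    (∀ T : ℝ, 0 ≤ T → IntervalIntegrable (Q.expCost d i) MeasureTheory.volume 0 T) ∧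
    Tendsto (fun T : ℝ => 1 / T * ∫ t in (0 : ℝ)..T, Q.expCost d i t) atTop (𝓝 a)

/-- `d` is optimal: it is efficient, its long-run average cost is finite, and it is minimal among
those of all efficient policies. (A policy without a finite average cost has cost `+∞`.) -/
def IsOptimal (Q : GroupQueue K) (d : Policy K) : Prop :=
  d ∈ Q.efficientPolicies ∧ ∃ a, Q.HasAverageCost d a ∧
    ∀ d' ∈ Q.efficientPolicies, ∀ a', Q.HasAverageCost d' a' → a ≤ a'

/-- `g` is a performance potential (relative value function) of the policy `d` with average cost
`a`, that is, it solves the Poisson equation `f - a + B g = 0`. -/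
def IsPotential (Q : GroupQueue K) (d : Policy K) (a : ℝ) (g : ℕ → ℝ) : Prop :=
  ∀ n, Q.cost n (d n) - a + Q.gen d g n = 0

/-- The action in state `n` of the multi-threshold policy with thresholds `θ`: once `θ k ≤ n`,
group `k` uses as many servers as it has and as the lower-numbered groups leave customers for;
below its threshold it is off. -/
def thresholdPolicy (Q : GroupQueue K) (θ : Fin K → ℕ) (n : ℕ) (k : Fin K) : ℕ :=
  if θ k ≤ n then
    min (Q.M k) (n - ∑ l ∈ (Finset.Iio k).attach, thresholdPolicy Q θ n l.1)
  else 0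
termination_by k.val
decreasing_by
  have hl := Finset.mem_Iio.mp l.2
  exact hl

theorem thresholdPolicy_eq (Q : GroupQueue K) (θ : Fin K → ℕ) (n : ℕ) (k : Fin K) :
    Q.thresholdPolicy θ n k =
      if θ k ≤ n then min (Q.M k) (n - ∑ l ∈ Finset.Iio k, Q.thresholdPolicy θ n l) else 0 := by
  rw [thresholdPolicy, Finset.sum_attach (Finset.Iio k) (fun l => Q.thresholdPolicy θ n l)]

/-- The admissible threshold vectors: positive and increasing in the group index. -/
def thresholdVectors (K : ℕ) : Set (Fin K → ℕ) := {θ | (∀ k, 1 ≤ θ k) ∧ Monotone θ}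

/-- `θ` is an optimal threshold vector: the policy it determines has a finite long-run average
cost, minimal among those of all admissible threshold vectors. -/
def IsOptimalThreshold (Q : GroupQueue K) (θ : Fin K → ℕ) : Prop :=
  θ ∈ thresholdVectors K ∧ ∃ a, Q.HasAverageCost (Q.thresholdPolicy θ) a ∧
    ∀ θ' ∈ thresholdVectors K, ∀ a', Q.HasAverageCost (Q.thresholdPolicy θ') a' → a ≤ a'

end GroupQueue

end

/-! In equilibrium the mean service rate equals `lam` for every policy, so refunding each unit of
service at the price `c 0 / mu 0` shifts all average costs by the same constant. In the resulting
`reducedCost`, group 0 is free and, since it has the least ratio `c / mu`, the other groups cost at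
least 0. Hence the reduced cost is at least `h n`, with equality when only group 0 works.

Let `r` be the mean reduced cost, and compare it with the mean over the tail of states from some `m
≥ 1` on. If the tail mean is at most `r`, then `h m < r`. Using group 0 alone up to `m` keeps the
tail weights and gives the states below `m` costs at most `h m`, so the policy improves
(`exists_boost_lt`). If the tail mean exceeds `r`, a faster or cheaper action in `m` puts less
weight on the expensive tail or lowers its cost, and again the policy improves (`exists_update_lt`).
So in an optimal policy every tail is expensive, and an unused server of group 0 could be added or
could replace a server of another group. A threshold above 1 for group 0 is the boundary case where
the tail carries all the mass. The claim on potentials is the Poisson equation in state 0 combined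
with `r > h 0`.

As costs are defined by time averages of the semigroup, two bridges are needed.
`HasAverageCost.exists_isStationary` yields a stationary law of no larger cost, by compactness of
occupation measures. `IsStationary.hasAverageCost` is the converse for positive laws, by
reversibility. -/

noncomputable section

namespace GroupQueue

/-! ### Exponentials of bounded operators. -/

section OperatorExponential

variable {E : Type*} [NormedAddCommGroup E] [NormedSpace ℝ E]

theorem exp_zero_smul_apply (A : E →L[ℝ] E) (g : E) :
    NormedSpace.exp ((0 : ℝ) • A) g = g := by
  simp [NormedSpace.exp_zero]

variable [CompleteSpace E]

theorem hasSum_exp_smul_apply (A : E →L[ℝ] E) (φ : E →L[ℝ] ℝ) (g : E) (t : ℝ) :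
    HasSum (fun r : ℕ => t ^ r / (r.factorial : ℝ) * φ ((A ^ r) g))
      (φ (NormedSpace.exp (t • A) g)) := by
  have h := NormedSpace.exp_series_hasSum_exp' (𝕂 := ℝ) (t • A)
  convert (h.mapL (ContinuousLinearMap.apply ℝ E g)).mapL φ using 2 with r
  · simp [smul_pow]
    ring
  · rfl

theorem hasDerivAt_exp_smul_apply (A : E →L[ℝ] E) (φ : E →L[ℝ] ℝ) (g : E) (t : ℝ) :
    HasDerivAt (fun t : ℝ => φ (NormedSpace.exp (t • A) g))
      (φ (NormedSpace.exp (t • A) (A g))) t := by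
  have h := hasDerivAt_exp_smul_const (𝕂 := ℝ) A t
  exact φ.hasFDerivAt.comp_hasDerivAt t
    ((ContinuousLinearMap.apply ℝ E g).hasFDerivAt.comp_hasDerivAt t h)

/-- Uniformization: a scalar shift commutes with `A`, and for a generator it can make all entries
nonnegative, so that positivity is visible in the exponential series. -/
theorem exp_smul_eq_uniformized (A : E →L[ℝ] E) (c t : ℝ) :
    NormedSpace.exp (t • A) = Real.exp (-(t * c)) • NormedSpace.exp (t • (A + c • 1)) := by
  let _ : NormedAlgebra ℚ (E →L[ℝ] E) := NormedAlgebra.restrictScalars ℚ ℝ (E →L[ℝ] E)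
  have hsplit : t • A = (-(t * c)) • (1 : E →L[ℝ] E) + t • (A + c • 1) := by
    module
  have hcomm : Commute ((-(t * c)) • (1 : E →L[ℝ] E)) (t • (A + c • 1)) :=
    (Commute.one_left _).smul_left _
  have hexp : NormedSpace.exp ((-(t * c)) • (1 : E →L[ℝ] E)) = Real.exp (-(t * c)) • 1 := by
    have := NormedSpace.algebraMap_exp_comm (𝕂 := ℝ) (𝔸 := E →L[ℝ] E) (-(t * c))
    rw [Algebra.algebraMap_eq_smul_one, Algebra.algebraMap_eq_smul_one] at this
    rw [← this, Real.exp_eq_exp_ℝ]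
  rw [hsplit, NormedSpace.exp_add_of_commute hcomm, hexp, smul_one_mul]

end OperatorExponential

/-! ### The transition semigroup on bounded functions. -/

variable {K : ℕ} {Q : GroupQueue K} {d : Policy K}

/-- The largest possible total service rate. -/
def maxRate (Q : GroupQueue K) : ℝ := ∑ k, (Q.M k : ℝ) * Q.mu k

theorem serviceRate_nonneg (hQ : Q.Standing) (m : Fin K → ℕ) : 0 ≤ Q.serviceRate m :=
  Finset.sum_nonneg fun k _ => mul_nonneg (Nat.cast_nonneg _) (hQ.mu_pos k).le

theorem serviceRate_le_maxRate (hQ : Q.Standing) (hd : d ∈ Q.efficientPolicies) (n : ℕ) :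
    Q.serviceRate (d n) ≤ Q.maxRate :=
  Finset.sum_le_sum fun k _ =>
    mul_le_mul_of_nonneg_right (Nat.cast_le.2 ((hd n).1 k)) (hQ.mu_pos k).le

theorem maxRate_nonneg (hQ : Q.Standing) : 0 ≤ Q.maxRate :=
  serviceRate_nonneg hQ Q.M

theorem efficient_zero (hd : d ∈ Q.efficientPolicies) : d 0 = 0 := by
  funext k
  have h := (Finset.sum_eq_zero_iff.1 (Nat.le_zero.1 (hd 0).2)) k (Finset.mem_univ k)
  simpa using h

theorem serviceRate_zero (hd : d ∈ Q.efficientPolicies) : Q.serviceRate (d 0) = 0 := by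
  simp [efficient_zero hd, serviceRate]

theorem gen_apply (g : ℕ → ℝ) (n : ℕ) :
    Q.gen d g n = Q.lam * (g (n + 1) - g n) + Q.serviceRate (d n) * (g (n - 1) - g n) := rfl

theorem abs_gen_le (hQ : Q.Standing) (hd : d ∈ Q.efficientPolicies) {g : ℕ → ℝ} {C : ℝ}
    (hg : ∀ n, |g n| ≤ C) (n : ℕ) : |Q.gen d g n| ≤ 2 * (Q.lam + Q.maxRate) * C := by
  have hC : 0 ≤ C := (abs_nonneg _).trans (hg 0)
  have h1 : ∀ a b, |g a - g b| ≤ 2 * C := fun a b => by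
    have := abs_sub (g a) (g b)
    linarith [hg a, hg b]
  rw [gen_apply]
  refine (abs_add_le _ _).trans ?_
  rw [abs_mul, abs_mul, abs_of_pos hQ.lam_pos, abs_of_nonneg (serviceRate_nonneg hQ _)]
  have h2 := mul_le_mul_of_nonneg_left (h1 (n + 1) n) hQ.lam_pos.le
  have h3 := mul_le_mul (serviceRate_le_maxRate hQ hd n) (h1 (n - 1) n) (abs_nonneg _)
    (maxRate_nonneg hQ)
  linarith

/-- The bounded functions of the state, with the supremum norm. -/
abbrev BddFun : Type := lp (fun _ : ℕ => ℝ) ⊤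

/-- A function of the state with a given bound, as an element of `BddFun`. -/
def BddFun.mk (g : ℕ → ℝ) (C : ℝ) (hg : ∀ n, |g n| ≤ C) : BddFun :=
  ⟨g, memℓp_infty ⟨C, by rintro _ ⟨n, rfl⟩; exact hg n⟩⟩

theorem BddFun.abs_apply_le (g : BddFun) (n : ℕ) : |g n| ≤ ‖g‖ :=
  lp.norm_apply_le_norm ENNReal.top_ne_zero g n

/-- The generator as a bounded operator on the bounded functions of the state. -/
def genBdd (hQ : Q.Standing) (hd : d ∈ Q.efficientPolicies) : BddFun →L[ℝ] BddFun :=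
  LinearMap.mkContinuous
    { toFun := fun g => BddFun.mk (Q.gen d g) _ (abs_gen_le hQ hd g.abs_apply_le)
      map_add' := fun g g' => by
        ext n
        exact congrFun ((Q.gen d).map_add (g : ℕ → ℝ) g') n
      map_smul' := fun r g => by
        ext n
        exact congrFun ((Q.gen d).map_smul r (g : ℕ → ℝ)) n }
    (2 * (Q.lam + Q.maxRate)) fun g =>
      lp.norm_le_of_forall_le (by
        have := hQ.lam_pos
        have := maxRate_nonneg hQ
        positivity) (abs_gen_le hQ hd g.abs_apply_le)

theorem coe_genBdd (hQ : Q.Standing) (hd : d ∈ Q.efficientPolicies) (g : BddFun) :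
    (genBdd hQ hd g : ℕ → ℝ) = Q.gen d g := rfl

theorem coe_genBdd_pow (hQ : Q.Standing) (hd : d ∈ Q.efficientPolicies) (r : ℕ) (g : BddFun) :
    ((genBdd hQ hd ^ r) g : ℕ → ℝ) = (Q.gen d ^ r) g := by
  induction r with
  | zero => rfl
  | succ r ih => rw [pow_succ', pow_succ', Module.End.mul_apply, ← ih, ← coe_genBdd hQ hd]; rfl

/-- The transition semigroup on the bounded functions of the state. -/
def semigroup (hQ : Q.Standing) (hd : d ∈ Q.efficientPolicies) (t : ℝ) :
    BddFun →L[ℝ] BddFun := NormedSpace.exp (t • genBdd hQ hd)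

/-- The indicator function of a set of states. -/
def ind (s : Set ℕ) : BddFun :=
  BddFun.mk (s.indicator 1) 1 fun n => by
    by_cases h : n ∈ s <;> simp [h]

theorem coe_ind (s : Set ℕ) : (ind s : ℕ → ℝ) = s.indicator 1 := rfl

theorem transProb_eq_semigroup (hQ : Q.Standing) (hd : d ∈ Q.efficientPolicies) (t : ℝ)
    (i j : ℕ) : Q.transProb d t i j = semigroup hQ hd t (ind {j}) i := by
  refine Eq.trans ?_ (hasSum_exp_smul_apply (genBdd hQ hd)
    (lp.evalCLM ℝ (fun _ : ℕ => ℝ) ⊤ i) (ind {j}) t).tsum_eq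
  have h1 : (Pi.single j 1 : ℕ → ℝ) = (ind {j} : ℕ → ℝ) := by
    rw [coe_ind]; funext n; simp [Pi.single_apply, Set.indicator_apply]
  rw [transProb, h1]
  congr 1
  funext r
  rw [← coe_genBdd_pow hQ hd]
  rfl

theorem hasDerivAt_semigroup (hQ : Q.Standing) (hd : d ∈ Q.efficientPolicies) (g : BddFun)
    (i : ℕ) (t : ℝ) :
    HasDerivAt (fun t => semigroup hQ hd t g i) (semigroup hQ hd t (genBdd hQ hd g) i) t :=
  hasDerivAt_exp_smul_apply (genBdd hQ hd) (lp.evalCLM ℝ (fun _ : ℕ => ℝ) ⊤ i) g t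

theorem semigroup_zero (hQ : Q.Standing) (hd : d ∈ Q.efficientPolicies) (g : BddFun) :
    semigroup hQ hd 0 g = g :=
  exp_zero_smul_apply (genBdd hQ hd) g

theorem semigroup_nonneg (hQ : Q.Standing) (hd : d ∈ Q.efficientPolicies) {g : BddFun}
    (hg : ∀ n, 0 ≤ g n) {t : ℝ} (ht : 0 ≤ t) (i : ℕ) : 0 ≤ semigroup hQ hd t g i := by
  -- `c` bounds the total jump rate out of every state, so `gen + c` preserves nonnegative
  -- functions.
  set c : ℝ := Q.lam + Q.maxRate
  set N : BddFun →L[ℝ] BddFun := genBdd hQ hd + c • 1 with hNdef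
  have hN : ∀ f : BddFun, (∀ n, 0 ≤ f n) → ∀ n, 0 ≤ N f n := fun f hf n => by
    change 0 ≤ (Q.lam * (f (n + 1) - f n) + Q.serviceRate (d n) * (f (n - 1) - f n)) + c * f n
    have h1 := mul_nonneg hQ.lam_pos.le (hf (n + 1))
    have h2 := mul_nonneg (serviceRate_nonneg hQ (d n)) (hf (n - 1))
    have h3 := mul_nonneg (sub_nonneg.2 (serviceRate_le_maxRate hQ hd n)) (hf n)
    simp only [c]
    linarith
  have hpow : ∀ r : ℕ, ∀ n, 0 ≤ (N ^ r) g n := fun r => by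
    induction r with
    | zero => exact hg
    | succ r ih => rw [pow_succ']; exact hN _ ih
  rw [semigroup, exp_smul_eq_uniformized _ c t]
  change 0 ≤ Real.exp (-(t * c)) * (NormedSpace.exp (t • N) g i)
  exact mul_nonneg (Real.exp_pos _).le ((hasSum_exp_smul_apply N
    (lp.evalCLM ℝ (fun _ : ℕ => ℝ) ⊤ i) g t).nonneg fun r =>
      mul_nonneg (by positivity) (hpow r i))

/-- The generator kills constants. This alone does not exclude loss of mass at infinity: the
constant 1 is not a norm limit of finitely supported functions, whence `hasSum_transProb`. -/
theorem semigroup_univ (hQ : Q.Standing) (hd : d ∈ Q.efficientPolicies) (t : ℝ) (i : ℕ) :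
    semigroup hQ hd t (ind Set.univ) i = 1 := by
  have h0 : genBdd hQ hd (ind Set.univ) = 0 := by
    ext n
    rw [coe_genBdd, coe_ind, gen_apply]
    simp
  have hderiv := hasDerivAt_semigroup hQ hd (ind Set.univ) i
  simp only [h0, map_zero] at hderiv
  have := is_const_of_deriv_eq_zero (fun x => (hderiv x).differentiableAt)
    (fun x => (hderiv x).deriv) t 0
  rw [this, semigroup_zero]
  simp [coe_ind]

theorem transProb_nonneg (hQ : Q.Standing) (hd : d ∈ Q.efficientPolicies) {t : ℝ} (ht : 0 ≤ t)
    (i j : ℕ) : 0 ≤ Q.transProb d t i j := by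
  rw [transProb_eq_semigroup hQ hd]
  exact semigroup_nonneg hQ hd (fun n => Set.indicator_nonneg (by simp) n) ht i

theorem continuous_transProb (hQ : Q.Standing) (hd : d ∈ Q.efficientPolicies) (i j : ℕ) :
    Continuous fun t => Q.transProb d t i j := by
  simp only [transProb_eq_semigroup hQ hd]
  exact continuous_iff_continuousAt.2 fun t => (hasDerivAt_semigroup hQ hd _ i t).continuousAt

theorem sum_transProb_eq_semigroup (hQ : Q.Standing) (hd : d ∈ Q.efficientPolicies) (t : ℝ)
    (i n : ℕ) :
    ∑ j ∈ Finset.range n, Q.transProb d t i j = semigroup hQ hd t (ind (Set.Iio n)) i := by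
  have h : ind (Set.Iio n) = ∑ j ∈ Finset.range n, ind {j} := by
    ext m
    rw [lp.coeFn_sum, Finset.sum_apply]
    simp [coe_ind, Set.indicator_apply]
  simp only [h, map_sum, lp.coeFn_sum, Finset.sum_apply,
    transProb_eq_semigroup hQ hd]

theorem sum_transProb_le_one (hQ : Q.Standing) (hd : d ∈ Q.efficientPolicies) {t : ℝ}
    (ht : 0 ≤ t) (i n : ℕ) : ∑ j ∈ Finset.range n, Q.transProb d t i j ≤ 1 := by
  rw [sum_transProb_eq_semigroup hQ hd, ← semigroup_univ hQ hd t i, ← sub_nonneg]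
  have : 0 ≤ semigroup hQ hd t (ind Set.univ - ind (Set.Iio n)) i :=
    semigroup_nonneg hQ hd (fun m => by
      simp only [lp.coeFn_sub, Pi.sub_apply, coe_ind, Set.indicator_univ,
        Pi.one_apply, Set.indicator_apply]
      split_ifs <;> simp) ht i
  rwa [map_sub] at this

/-- Kolmogorov's forward equation, summed over the states `0, …, n`. -/
theorem hasDerivAt_sum_transProb (hQ : Q.Standing) (hd : d ∈ Q.efficientPolicies) (i n : ℕ)
    (t : ℝ) :
    HasDerivAt (fun t => ∑ j ∈ Finset.range (n + 1), Q.transProb d t i j)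
      (Q.serviceRate (d (n + 1)) * Q.transProb d t i (n + 1) - Q.lam * Q.transProb d t i n) t := by
  -- Only jumps across the cut between `n` and `n + 1` change the indicator of `{0, …, n}`.
  have h : genBdd hQ hd (ind (Set.Iio (n + 1))) =
      Q.serviceRate (d (n + 1)) • ind {n + 1} - Q.lam • ind {n} := by
    ext m
    simp only [coe_genBdd, gen_apply, coe_ind, lp.coeFn_sub,
      lp.coeFn_smul, Pi.sub_apply, Set.indicator_apply, Set.mem_Iio,
      Pi.one_apply]
    rcases lt_trichotomy m n with hm | rfl | hm
    · simp [show m < n + 1 by omega, hm, show m - 1 < n + 1 by omega, show m ≠ n + 1 by omega,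
        hm.ne]
    · simp [show m - 1 < m + 1 by omega]
    · rcases Nat.lt_or_ge (n + 1) m with hm' | hm'
      · simp [show ¬ m < n + 1 by omega, show ¬ m - 1 < n + 1 by omega, show m ≠ n + 1 by omega,
          hm.ne', show ¬ m < n by omega]
      · obtain rfl : m = n + 1 := by omega
        simp
  have := hasDerivAt_semigroup hQ hd (ind (Set.Iio (n + 1))) i t
  simp only [sum_transProb_eq_semigroup hQ hd]
  simp only [transProb_eq_semigroup hQ hd]
  rw [h, map_sub, map_smul, map_smul] at this
  exact this

theorem transProb_zero (hQ : Q.Standing) (hd : d ∈ Q.efficientPolicies) (i j : ℕ) :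
    Q.transProb d 0 i j = if i = j then 1 else 0 := by
  rw [transProb_eq_semigroup hQ hd, semigroup_zero]
  simp [coe_ind, Set.indicator_apply]

theorem integral_sum_transProb (hQ : Q.Standing) (hd : d ∈ Q.efficientPolicies) (i n : ℕ)
    (T : ℝ) :
    ∑ j ∈ Finset.range (n + 1), Q.transProb d T i j
        - ∑ j ∈ Finset.range (n + 1), Q.transProb d 0 i j
      = Q.serviceRate (d (n + 1)) * (∫ t in (0 : ℝ)..T, Q.transProb d t i (n + 1))
        - Q.lam * ∫ t in (0 : ℝ)..T, Q.transProb d t i n := by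
  have hc := continuous_transProb hQ hd i
  rw [← intervalIntegral.integral_const_mul, ← intervalIntegral.integral_const_mul,
    ← intervalIntegral.integral_sub (((hc _).const_mul _).intervalIntegrable _ _)
      (((hc _).const_mul _).intervalIntegrable _ _)]
  exact (intervalIntegral.integral_eq_sub_of_hasDerivAt
    (fun t _ => hasDerivAt_sum_transProb hQ hd i n t)
    (((continuous_const.mul (hc _)).sub (continuous_const.mul (hc _))).intervalIntegrable _ _)).symm

/-- The process does not explode: the transition probabilities from a state add up to `1`. -/
theorem hasSum_transProb (hQ : Q.Standing) (hd : d ∈ Q.efficientPolicies) {t : ℝ} (ht : 0 ≤ t)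
    (i : ℕ) : HasSum (Q.transProb d t i) 1 := by
  have hc := continuous_transProb hQ hd i
  have hint : ∀ j, 0 ≤ ∫ u in (0 : ℝ)..t, Q.transProb d u i j := fun j =>
    intervalIntegral.integral_nonneg ht fun u hu => transProb_nonneg hQ hd hu.1 i j
  -- The times spent in the various states up to `t` add up to at most `t`, so the flow upward out
  -- of `n` vanishes as `n` grows.
  have hsummable : Summable fun j => ∫ u in (0 : ℝ)..t, Q.transProb d u i j := by
    refine summable_of_sum_range_le (c := t) hint fun n => ?_
    rw [← intervalIntegral.integral_finsetSum fun j _ => (hc j).intervalIntegrable _ _]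
    calc _ ≤ ∫ u in (0 : ℝ)..t, (1 : ℝ) :=
          intervalIntegral.integral_mono_on ht
            ((continuous_finsetSum _ fun j _ => hc j).intervalIntegrable _ _)
            (continuous_const.intervalIntegrable _ _)
            fun u hu => sum_transProb_le_one hQ hd hu.1 i n
      _ = t := by simp
  rw [hasSum_iff_tendsto_nat_of_nonneg (fun j => transProb_nonneg hQ hd ht i j),
    ← tendsto_add_atTop_iff_nat 1]
  have hlow : Tendsto (fun n => 1 - Q.lam * ∫ u in (0 : ℝ)..t, Q.transProb d u i n) atTop
      (𝓝 1) := by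
    simpa using (hsummable.tendsto_atTop_zero.const_mul Q.lam).const_sub 1
  refine tendsto_of_tendsto_of_tendsto_of_le_of_le' hlow tendsto_const_nhds ?_
    (Eventually.of_forall fun n => sum_transProb_le_one hQ hd ht i (n + 1))
  filter_upwards [eventually_ge_atTop i] with n hn
  have h := integral_sum_transProb hQ hd i n t
  have h0 : ∑ j ∈ Finset.range (n + 1), Q.transProb d 0 i j = 1 := by
    simp only [transProb_zero hQ hd, Finset.sum_ite_eq, Finset.mem_range]
    simp [Nat.lt_succ_of_le hn]
  have := mul_nonneg (serviceRate_nonneg hQ (d (n + 1))) (hint (n + 1))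
  linarith

theorem transProb_le_one (hQ : Q.Standing) (hd : d ∈ Q.efficientPolicies) {t : ℝ} (ht : 0 ≤ t)
    (i j : ℕ) : Q.transProb d t i j ≤ 1 :=
  le_hasSum (hasSum_transProb hQ hd ht i) j fun k _ => transProb_nonneg hQ hd ht i k

/-- Detailed balance for the powers of the generator. -/
theorem gen_pow_reversible (hd : d ∈ Q.efficientPolicies) {α : ℕ → ℝ}
    (hα : ∀ n, Q.lam * α n = Q.serviceRate (d (n + 1)) * α (n + 1)) (r : ℕ) :
    ∀ i j, α i * (Q.gen d ^ r) (Pi.single j 1) i = α j * (Q.gen d ^ r) (Pi.single i 1) j := by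
  induction r with
  | zero =>
    intro i j
    rcases eq_or_ne i j with rfl | h
    · rfl
    · simp [h, h.symm]
  | succ r ih =>
    intro i j
    -- One generator is peeled off on the outside here and on the inside in `hsucc`. Both sides
    -- become combinations of `r`-th powers at `i - 1`, `i`, `i + 1`, matched by `ih` and `hα`.
    have hback : (Q.gen d ^ (r + 1)) (Pi.single j 1) i =
        Q.lam * ((Q.gen d ^ r) (Pi.single j 1) (i + 1) - (Q.gen d ^ r) (Pi.single j 1) i)
        + Q.serviceRate (d i) * ((Q.gen d ^ r) (Pi.single j 1) (i - 1)
          - (Q.gen d ^ r) (Pi.single j 1) i) := by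
      rw [pow_succ']; rfl
    have hfwd : Q.gen d (Pi.single i 1) = Q.serviceRate (d (i + 1)) • Pi.single (i + 1) 1
        - (Q.lam + Q.serviceRate (d i)) • Pi.single i 1
        + if i = 0 then 0 else Q.lam • Pi.single (i - 1) 1 := by
      funext m
      rw [gen_apply]
      rcases i with _ | i
      · rcases m with _ | _ | m
        · simp [serviceRate_zero hd]
        · simp
        · simp
      · simp only [Pi.add_apply, Pi.sub_apply, Pi.smul_apply, Pi.single_apply, smul_eq_mul,
          Nat.add_sub_cancel, Nat.succ_ne_zero, if_false]
        rcases lt_trichotomy m (i + 1) with hm | rfl | hm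
        · rcases Nat.lt_or_ge m i with hm' | hm'
          · simp [show m ≠ i by omega, show m ≠ i + 1 by omega, show m - 1 ≠ i + 1 by omega,
              show m ≠ i + 1 + 1 by omega]
          · obtain rfl : m = i := by omega
            simp [show m - 1 ≠ m + 1 by omega, show m ≠ m + 1 + 1 by omega]
        · simp
          ring
        · rcases Nat.lt_or_ge (i + 2) m with hm' | hm'
          · simp [show m ≠ i by omega, show m ≠ i + 1 by omega, show m - 1 ≠ i + 1 by omega,
              show m ≠ i + 1 + 1 by omega]
          · obtain rfl : m = i + 2 := by omega
            simp
    have hsucc : (Q.gen d ^ (r + 1)) (Pi.single i 1) =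
        (Q.gen d ^ r) (Q.gen d (Pi.single i 1)) := by
      rw [pow_succ]; rfl
    rw [hback, hsucc, hfwd, map_add, map_sub, map_smul, map_smul]
    have h1 := ih (i + 1) j
    have h2 := ih i j
    have h3 := hα i
    rcases i with _ | i
    · simp only [serviceRate_zero hd, if_true, map_zero, Pi.add_apply, Pi.sub_apply,
        Pi.smul_apply, Pi.zero_apply, smul_eq_mul]
      linear_combination Q.serviceRate (d (0 + 1)) * h1 - Q.lam * h2
        + (Q.gen d ^ r) (Pi.single j 1) (0 + 1) * h3
    · have h4 := ih i j
      have h5 := hα i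
      simp only [Nat.add_sub_cancel, Nat.succ_ne_zero, if_false, map_smul, Pi.add_apply,
        Pi.sub_apply, Pi.smul_apply, smul_eq_mul]
      linear_combination Q.serviceRate (d (i + 1 + 1)) * h1
        - (Q.lam + Q.serviceRate (d (i + 1))) * h2 + Q.lam * h4
        + (Q.gen d ^ r) (Pi.single j 1) (i + 1 + 1) * h3
        - (Q.gen d ^ r) (Pi.single j 1) i * h5

theorem transProb_reversible (hd : d ∈ Q.efficientPolicies) {α : ℕ → ℝ}
    (hα : ∀ n, Q.lam * α n = Q.serviceRate (d (n + 1)) * α (n + 1)) (t : ℝ) (i j : ℕ) :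
    α i * Q.transProb d t i j = α j * Q.transProb d t j i := by
  simp only [transProb, ← tsum_mul_left]
  congr 1
  funext r
  linear_combination t ^ r / (r.factorial : ℝ) * gen_pow_reversible hd hα r i j

/-! ### Occupation measures and stationary distributions. -/

/-- A stationary distribution, in detailed balance, of the process under the policy `d`, for which
the cost rate has a finite mean. -/
structure IsStationary (Q : GroupQueue K) (d : Policy K) (α : ℕ → ℝ) : Prop where
  nonneg : ∀ n, 0 ≤ α n
  balance : ∀ n, Q.lam * α n = Q.serviceRate (d (n + 1)) * α (n + 1)
  hasSum_one : HasSum α 1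
  summable_cost : Summable fun n => α n * Q.cost n (d n)

/-- The expected fraction of the time until `T` that is spent in state `n`, starting in `i`. -/
def occupation (Q : GroupQueue K) (d : Policy K) (i : ℕ) (T : ℝ) (n : ℕ) : ℝ :=
  1 / T * ∫ t in (0 : ℝ)..T, Q.transProb d t i n

theorem occupation_nonneg (hQ : Q.Standing) (hd : d ∈ Q.efficientPolicies) {T : ℝ} (hT : 0 < T)
    (i n : ℕ) : 0 ≤ Q.occupation d i T n :=
  mul_nonneg (by positivity) (intervalIntegral.integral_nonneg hT.le fun _ hu =>
    transProb_nonneg hQ hd hu.1 i n)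

theorem occupation_le (hQ : Q.Standing) (hd : d ∈ Q.efficientPolicies) {T : ℝ} (hT : 0 < T)
    {i n : ℕ} {C : ℝ} (hC : ∀ t, 0 ≤ t → Q.transProb d t i n ≤ C) : Q.occupation d i T n ≤ C := by
  have : ∫ t in (0 : ℝ)..T, Q.transProb d t i n ≤ ∫ t in (0 : ℝ)..T, C :=
    intervalIntegral.integral_mono_on hT.le
      ((continuous_transProb hQ hd i n).intervalIntegrable _ _)
      (continuous_const.intervalIntegrable _ _) fun u hu => hC u hu.1
  rw [intervalIntegral.integral_const, smul_eq_mul, sub_zero] at this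
  rw [occupation, one_div, inv_mul_le_iff₀ hT]
  exact this

/-- The net flow across a cut during `[0, T]` is the change of a probability, hence at most 1 in
absolute value; dividing by `T` kills it. -/
theorem tendsto_occupation_balance (hQ : Q.Standing) (hd : d ∈ Q.efficientPolicies) (i n : ℕ) :
    Tendsto (fun T => Q.serviceRate (d (n + 1)) * Q.occupation d i T (n + 1)
      - Q.lam * Q.occupation d i T n) atTop (𝓝 0) := by
  have h : ∀ᶠ T : ℝ in atTop, ‖Q.serviceRate (d (n + 1)) * Q.occupation d i T (n + 1)
      - Q.lam * Q.occupation d i T n‖ ≤ T⁻¹ := by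
    filter_upwards [eventually_gt_atTop 0] with T hT
    have h1 := integral_sum_transProb hQ hd i n T
    have h2 : Q.serviceRate (d (n + 1)) * Q.occupation d i T (n + 1)
        - Q.lam * Q.occupation d i T n = T⁻¹ * (∑ j ∈ Finset.range (n + 1), Q.transProb d T i j
        - ∑ j ∈ Finset.range (n + 1), Q.transProb d 0 i j) := by
      rw [h1, occupation, occupation]
      ring
    have h3 : ∀ t, 0 ≤ t → 0 ≤ ∑ j ∈ Finset.range (n + 1), Q.transProb d t i j := fun t ht =>
      Finset.sum_nonneg fun j _ => transProb_nonneg hQ hd ht i j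
    have h4 := sum_transProb_le_one hQ hd hT.le i (n + 1)
    have h5 := sum_transProb_le_one hQ hd le_rfl i (n + 1)
    rw [h2, norm_mul, Real.norm_of_nonneg (by positivity)]
    refine mul_le_of_le_one_right (by positivity) (abs_sub_le_iff.2 ⟨?_, ?_⟩)
    · linarith [h3 0 le_rfl]
    · linarith [h3 T hT.le]
  exact squeeze_zero_norm' h tendsto_inv_atTop_zero

/-- A bound for the absolute value of the operating cost rate. -/
def maxOperatingCost (Q : GroupQueue K) : ℝ := ∑ k, (Q.M k : ℝ) * |Q.c k|

theorem le_cost (hd : d ∈ Q.efficientPolicies) (n : ℕ) :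
    Q.h n - Q.maxOperatingCost ≤ Q.cost n (d n) := by
  have : -Q.maxOperatingCost ≤ ∑ k, (d n k : ℝ) * Q.c k := by
    rw [maxOperatingCost, ← Finset.sum_neg_distrib]
    refine Finset.sum_le_sum fun k _ => ?_
    have h1 : (d n k : ℝ) * |Q.c k| ≤ Q.M k * |Q.c k| :=
      mul_le_mul_of_nonneg_right (Nat.cast_le.2 ((hd n).1 k)) (abs_nonneg _)
    have h2 : (d n k : ℝ) * (-|Q.c k|) ≤ d n k * Q.c k :=
      mul_le_mul_of_nonneg_left (neg_abs_le _) (Nat.cast_nonneg _)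
    linarith
  rw [cost]
  linarith

/-- Subtracting `R` makes the cost nonnegative from `n` on, so those terms can be dropped. Only
finitely many states remain, as is needed to let `T` tend to infinity. -/
theorem sum_occupation_cost_le (hQ : Q.Standing) (hd : d ∈ Q.efficientPolicies) {i : ℕ}
    (hs : ∀ t : ℝ, 0 ≤ t → Summable fun j => Q.transProb d t i j * Q.cost j (d j))
    (hi : ∀ T : ℝ, 0 ≤ T → IntervalIntegrable (Q.expCost d i) MeasureTheory.volume 0 T)
    {T : ℝ} (hT : 0 < T) {n : ℕ} {R : ℝ} (hR : ∀ j, n ≤ j → R ≤ Q.cost j (d j)) :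
    ∑ j ∈ Finset.range n, Q.occupation d i T j * Q.cost j (d j)
      + R * (1 - ∑ j ∈ Finset.range n, Q.occupation d i T j)
      ≤ 1 / T * ∫ t in (0 : ℝ)..T, Q.expCost d i t := by
  have hc := continuous_transProb hQ hd i
  have hpt : ∀ t ∈ Set.Icc (0 : ℝ) T,
      ∑ j ∈ Finset.range n, Q.transProb d t i j * (Q.cost j (d j) - R) ≤ Q.expCost d i t - R := by
    intro t ht
    have hP := hasSum_transProb hQ hd ht.1 i
    have h1 : HasSum (fun j => Q.transProb d t i j * (Q.cost j (d j) - R))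
        (Q.expCost d i t - R) := by
      have := (hs t ht.1).hasSum.sub (hP.mul_right R)
      simpa only [mul_sub, one_mul, expCost] using this
    exact sum_le_hasSum _ (fun j hj => mul_nonneg (transProb_nonneg hQ hd ht.1 i j)
      (sub_nonneg.2 (hR j (by simpa using hj)))) h1
  have hmono := intervalIntegral.integral_mono_on hT.le
    ((continuous_finsetSum _ fun j _ => (hc j).mul_const _).intervalIntegrable _ _)
    ((hi T hT.le).sub (continuous_const.intervalIntegrable _ _)) hpt
  rw [intervalIntegral.integral_finsetSum fun j _ => ((hc j).mul_const _).intervalIntegrable _ _,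
    intervalIntegral.integral_sub (hi T hT.le) (continuous_const.intervalIntegrable _ _),
    intervalIntegral.integral_const, smul_eq_mul, sub_zero] at hmono
  simp only [intervalIntegral.integral_mul_const] at hmono
  have hmono' := mul_le_mul_of_nonneg_left hmono (show 0 ≤ 1 / T by positivity)
  rw [Finset.mul_sum, mul_sub, ← mul_assoc (1 / T) T R, one_div_mul_cancel hT.ne', one_mul] at hmono'
  have hre : ∑ j ∈ Finset.range n, 1 / T * ((∫ t in (0 : ℝ)..T, Q.transProb d t i j)
        * (Q.cost j (d j) - R))
      = ∑ j ∈ Finset.range n, Q.occupation d i T j * Q.cost j (d j)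
        - R * ∑ j ∈ Finset.range n, Q.occupation d i T j := by
    rw [Finset.mul_sum, ← Finset.sum_sub_distrib]
    exact Finset.sum_congr rfl fun j _ => by rw [occupation]; ring
  linarith

/-- A policy with a finite average cost has a stationary distribution, whose mean cost rate does
not exceed the average cost. -/
theorem HasAverageCost.exists_isStationary (hQ : Q.Standing) (hd : d ∈ Q.efficientPolicies)
    {a : ℝ} (ha : Q.HasAverageCost d a) :
    ∃ α, Q.IsStationary d α ∧ ∑' n, α n * Q.cost n (d n) ≤ a := by
  obtain ⟨hs, hi, hlim⟩ := ha 0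
  -- Along an ultrafilter the occupations of all states converge at once, without a diagonal
  -- argument.
  set U : Ultrafilter ℝ := Ultrafilter.of atTop
  have hU : (U : Filter ℝ) ≤ atTop := Ultrafilter.of_le _
  have hpos : ∀ᶠ T : ℝ in U, 0 < T := hU (eventually_gt_atTop 0)
  have hex : ∀ n, ∃ x, Tendsto (fun T => Q.occupation d 0 T n) U (𝓝 x) := fun n => by
    have hmem : ∀ᶠ T in U, Q.occupation d 0 T n ∈ Set.Icc (0 : ℝ) 1 := by
      filter_upwards [hpos] with T hT
      exact ⟨occupation_nonneg hQ hd hT 0 n,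
        occupation_le hQ hd hT fun t ht => transProb_le_one hQ hd ht 0 n⟩
    obtain ⟨x, -, hx⟩ := isCompact_Icc.ultrafilter_le_nhds
      (U.map fun T => Q.occupation d 0 T n) (le_principal_iff.2 hmem)
    exact ⟨x, hx⟩
  choose α hα using hex
  have hnonneg : ∀ n, 0 ≤ α n := fun n =>
    ge_of_tendsto (hα n) (hpos.mono fun T hT => occupation_nonneg hQ hd hT 0 n)
  have hbal : ∀ n, Q.lam * α n = Q.serviceRate (d (n + 1)) * α (n + 1) := fun n => by
    have h1 := ((hα (n + 1)).const_mul (Q.serviceRate (d (n + 1)))).sub ((hα n).const_mul Q.lam)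
    have h2 := tendsto_nhds_unique h1 ((tendsto_occupation_balance hQ hd 0 n).mono_left hU)
    linarith
  set C := Q.maxOperatingCost
  have hkey : ∀ n, ∑ j ∈ Finset.range n, α j * Q.cost j (d j)
      + (Q.h n - C) * (1 - ∑ j ∈ Finset.range n, α j) ≤ a := fun n => by
    refine le_of_tendsto_of_tendsto ((tendsto_finsetSum _ fun j _ => (hα j).mul_const _).add
      (((tendsto_finsetSum _ fun j _ => hα j).const_sub 1).const_mul _)) (hlim.mono_left hU) ?_
    filter_upwards [hpos] with T hT
    exact sum_occupation_cost_le hQ hd hs hi hT fun j hj =>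
      (sub_le_sub_right (hQ.h_mono hj) _).trans (le_cost hd j)
  have hle1 : ∀ n, ∑ j ∈ Finset.range n, α j ≤ 1 := fun n => by
    refine le_of_tendsto (tendsto_finsetSum _ fun j _ => hα j) ?_
    filter_upwards [hpos] with T hT
    simp only [occupation]
    rw [← Finset.mul_sum, ← intervalIntegral.integral_finsetSum fun j _ =>
      (continuous_transProb hQ hd 0 j).intervalIntegrable _ _, one_div, inv_mul_le_iff₀ hT]
    calc _ ≤ ∫ u in (0 : ℝ)..T, (1 : ℝ) :=
          intervalIntegral.integral_mono_on hT.le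
            ((continuous_finsetSum _ fun j _ => continuous_transProb hQ hd 0 j).intervalIntegrable
              _ _)
            (continuous_const.intervalIntegrable _ _)
            fun u hu => sum_transProb_le_one hQ hd hu.1 0 n
      _ = T * 1 := by simp
  set L := Q.h 0 - C
  have hL : ∀ n, L ≤ Q.cost n (d n) := fun n =>
    (sub_le_sub_right (hQ.h_mono (Nat.zero_le n)) _).trans (le_cost hd n)
  have hlow : ∀ n, -|L| ≤ ∑ j ∈ Finset.range n, α j * Q.cost j (d j) := fun n => by
    have h1 : ∑ j ∈ Finset.range n, α j * (-|L|) ≤ ∑ j ∈ Finset.range n, α j * Q.cost j (d j) :=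
      Finset.sum_le_sum fun j _ =>
        mul_le_mul_of_nonneg_left ((neg_abs_le L).trans (hL j)) (hnonneg j)
    rw [← Finset.sum_mul] at h1
    have h2 := mul_le_mul_of_nonneg_right (hle1 n) (abs_nonneg L)
    linarith
  have hR : Tendsto (fun n => Q.h n - C) atTop atTop :=
    tendsto_atTop_add_const_right _ _ hQ.h_tendsto
  have hsum : HasSum α 1 := by
    rw [hasSum_iff_tendsto_nat_of_nonneg hnonneg]
    -- Tightness: by `hkey`, mass missing from the first `n` states costs at least `h n - C` per
    -- unit, and the total is bounded.
    have h1 : Tendsto (fun n => 1 - (a + |L|) / (Q.h n - C)) atTop (𝓝 1) := by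
      simpa using (tendsto_const_nhds.div_atTop hR).const_sub 1
    refine tendsto_of_tendsto_of_tendsto_of_le_of_le' h1 tendsto_const_nhds ?_
      (Eventually.of_forall hle1)
    filter_upwards [hR.eventually_gt_atTop 0] with n hn
    rw [sub_le_comm, le_div_iff₀ hn]
    linarith [hkey n, hlow n]
  have hpart : ∀ᶠ n in atTop, ∑ j ∈ Finset.range n, α j * Q.cost j (d j) ≤ a := by
    filter_upwards [hR.eventually_ge_atTop 0] with n hn
    have := mul_nonneg hn (sub_nonneg.2 (hle1 n))
    linarith [hkey n]
  have hsummable : Summable fun n => α n * Q.cost n (d n) := by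
    have h1 : Summable fun n => α n * (Q.cost n (d n) - L) := by
      have hnn : ∀ n, 0 ≤ α n * (Q.cost n (d n) - L) := fun n =>
        mul_nonneg (hnonneg n) (sub_nonneg.2 (hL n))
      obtain ⟨N, hN⟩ := eventually_atTop.1 hpart
      refine summable_of_sum_range_le (c := a + |L|) hnn fun n => ?_
      refine (Finset.sum_le_sum_of_subset_of_nonneg
        (Finset.range_mono (le_max_left n N)) fun j _ _ => hnn j).trans ?_
      have h2 := hN (max n N) (le_max_right n N)
      have h3 := mul_le_mul_of_nonneg_right (hle1 (max n N)) (abs_nonneg L)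
      have h4 := mul_le_mul_of_nonneg_left (neg_abs_le L)
        (Finset.sum_nonneg fun j (_ : j ∈ Finset.range (max n N)) => hnonneg j)
      simp only [mul_sub, Finset.sum_sub_distrib, ← Finset.sum_mul]
      linarith
    have := h1.add (hsum.summable.mul_right L)
    refine this.congr fun n => ?_
    ring
  exact ⟨α, ⟨hnonneg, hbal, hsum, hsummable⟩,
    le_of_tendsto hsummable.hasSum.tendsto_sum_nat hpart⟩

/-- The ergodic theorem: if the stationary distribution charges every state, the long-run average
cost is the mean of the cost rate, whatever the initial state. -/
theorem IsStationary.hasAverageCost (hQ : Q.Standing) (hd : d ∈ Q.efficientPolicies)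
    {α : ℕ → ℝ} (hα : Q.IsStationary d α) (hpos : ∀ n, 0 < α n) :
    Q.HasAverageCost d (∑' n, α n * Q.cost n (d n)) := by
  intro i
  -- Reversibility bounds each row of the semigroup by a multiple of `α`, uniformly in time; this
  -- dominates every sum and integral below.
  have hP : ∀ t, 0 ≤ t → ∀ j, Q.transProb d t i j ≤ α j / α i := fun t ht j => by
    rw [le_div_iff₀ (hpos i), mul_comm, transProb_reversible hd hα.balance]
    exact mul_le_of_le_one_right (hpos j).le (transProb_le_one hQ hd ht j i)
  have hbound : ∀ f : ℕ → ℝ, ∀ t, 0 ≤ t → ∀ j,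
      ‖Q.transProb d t i j * f j‖ ≤ (α i)⁻¹ * |α j * f j| := fun f t ht j => by
    rw [Real.norm_eq_abs, abs_mul, abs_mul, abs_of_nonneg (transProb_nonneg hQ hd ht i j),
      abs_of_pos (hpos j), ← mul_assoc, inv_mul_eq_div]
    exact mul_le_mul_of_nonneg_right (hP t ht j) (abs_nonneg _)
  have hsb : ∀ f : ℕ → ℝ, Summable (fun j => α j * f j) →
      Summable fun j => (α i)⁻¹ * |α j * f j| := fun f hf => hf.abs.mul_left _
  have hswap : ∀ f : ℕ → ℝ, Summable (fun j => α j * f j) → ∀ T, 0 < T →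
      HasSum (fun j => Q.occupation d i T j * f j)
        (1 / T * ∫ t in (0 : ℝ)..T, ∑' j, Q.transProb d t i j * f j) := fun f hf T hT => by
    have hmem : ∀ t ∈ Set.uIoc (0 : ℝ) T, 0 ≤ t := fun t ht => by
      rw [Set.uIoc_of_le hT.le] at ht
      exact ht.1.le
    have := (intervalIntegral.hasSum_integral_of_dominated_convergence
      (μ := MeasureTheory.volume) (a := 0) (b := T)
      (F := fun j t => Q.transProb d t i j * f j)
      (fun j _ => (α i)⁻¹ * |α j * f j|)
      (fun j => ((continuous_transProb hQ hd i j).mul_const _).aestronglyMeasurable)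
      (fun j => Eventually.of_forall fun t ht => hbound f t (hmem t ht) j)
      (Eventually.of_forall fun _ _ => hsb f hf)
      (continuous_const.intervalIntegrable _ _)
      (Eventually.of_forall fun t ht =>
        ((hsb f hf).of_norm_bounded fun j => hbound f t (hmem t ht) j).hasSum)).mul_left (1 / T)
    refine this.congr_fun fun j => ?_
    rw [occupation, intervalIntegral.integral_mul_const]
    ring
  have hoccle : ∀ T, 0 < T → ∀ j, |Q.occupation d i T j| ≤ α j / α i := fun T hT j => by
    rw [abs_of_nonneg (occupation_nonneg hQ hd hT i j)]
    exact occupation_le hQ hd hT fun t ht => hP t ht j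
  have hocc1 : ∀ T, 0 < T → HasSum (Q.occupation d i T) 1 := fun T hT => by
    have := hswap (fun _ => 1) (by simpa using hα.hasSum_one.summable) T hT
    simp only [mul_one] at this
    have h1 : ∫ t in (0 : ℝ)..T, ∑' j, Q.transProb d t i j = ∫ t in (0 : ℝ)..T, (1 : ℝ) :=
      intervalIntegral.integral_congr fun t ht => by
        rw [Set.uIcc_of_le hT.le] at ht
        exact (hasSum_transProb hQ hd ht.1 i).tsum_eq
    rw [h1, intervalIntegral.integral_const, smul_eq_mul, sub_zero, mul_one,
      one_div_mul_cancel hT.ne'] at this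
    exact this
  -- The cut equations make the occupations asymptotically proportional to `α`.
  have hrel : ∀ j, Tendsto (fun T => Q.occupation d i T j - α j / α 0 * Q.occupation d i T 0)
      atTop (𝓝 0) := fun j => by
    induction j with
    | zero => simp [div_self (hpos 0).ne']
    | succ j ih =>
      have hb := hα.balance j
      have hs : 0 < Q.serviceRate (d (j + 1)) := by
        refine pos_of_mul_pos_left ?_ (hpos (j + 1)).le
        rw [← hb]
        exact mul_pos hQ.lam_pos (hpos j)
      have h := ((tendsto_occupation_balance hQ hd i j).add (ih.const_mul Q.lam)).const_mul
        (Q.serviceRate (d (j + 1)))⁻¹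
      simp only [mul_zero, add_zero] at h
      refine h.congr fun T => ?_
      have h0 := (hpos 0).ne'
      field_simp
      linear_combination (-Q.occupation d i T 0) * hb
  -- Total mass 1 on both sides fixes the factor of proportionality.
  have hocc0 : Tendsto (fun T => Q.occupation d i T 0) atTop (𝓝 (α 0)) := by
    have hdom : Summable fun j => α j / α i + α j / α 0 * (α 0 / α i) :=
      (hα.hasSum_one.summable.div_const _).add
        ((hα.hasSum_one.summable.div_const _).mul_right _)
    have h1 := tendsto_tsum_of_dominated_convergence (𝓕 := atTop)
      (f := fun T j => Q.occupation d i T j - α j / α 0 * Q.occupation d i T 0) (g := fun _ => 0)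
      hdom hrel (by
        filter_upwards [eventually_gt_atTop 0] with T hT j
        refine (norm_sub_le _ _).trans (add_le_add (hoccle T hT j) ?_)
        rw [norm_mul, Real.norm_of_nonneg (div_nonneg (hpos j).le (hpos 0).le)]
        exact mul_le_mul_of_nonneg_left (hoccle T hT 0) (div_nonneg (hpos j).le (hpos 0).le))
    rw [tsum_zero] at h1
    have h2 : (fun T => ∑' j, (Q.occupation d i T j - α j / α 0 * Q.occupation d i T 0))
        =ᶠ[atTop] fun T => 1 - Q.occupation d i T 0 / α 0 := by
      filter_upwards [eventually_gt_atTop 0] with T hT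
      refine ((hocc1 T hT).sub ((hα.hasSum_one.div_const (α 0)).mul_right
        (Q.occupation d i T 0))).tsum_eq.trans ?_
      ring
    have h3 := ((h1.congr' h2).const_sub 1).mul_const (α 0)
    rw [sub_zero, one_mul] at h3
    refine h3.congr fun T => ?_
    have h0 := (hpos 0).ne'
    field_simp
    ring
  have hocc : ∀ j, Tendsto (fun T => Q.occupation d i T j) atTop (𝓝 (α j)) := fun j => by
    have h := (hrel j).add (hocc0.const_mul (α j / α 0))
    rw [zero_add, div_mul_cancel₀ _ (hpos 0).ne'] at h
    exact h.congr fun T => by ring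
  have hf := hα.summable_cost
  refine ⟨fun t ht => (hsb _ hf).of_norm_bounded (hbound _ t ht), fun T hT => ?_, ?_⟩
  · have hcont : ContinuousOn (Q.expCost d i) (Set.Ici 0) :=
      continuousOn_tsum (fun j => ((continuous_transProb hQ hd i j).mul_const _).continuousOn)
        (hsb _ hf) fun j t ht => hbound (fun j => Q.cost j (d j)) t ht j
    refine (hcont.mono ?_).intervalIntegrable
    rw [Set.uIcc_of_le hT]
    exact Set.Icc_subset_Ici_self
  · have h1 := tendsto_tsum_of_dominated_convergence (𝓕 := atTop)
      (f := fun T j => Q.occupation d i T j * Q.cost j (d j))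
      (hsb _ hf) (fun j => (hocc j).mul_const _) (by
        filter_upwards [eventually_gt_atTop 0] with T hT j
        rw [Real.norm_eq_abs, abs_mul, abs_mul, abs_of_pos (hpos j), ← mul_assoc, inv_mul_eq_div]
        exact mul_le_mul_of_nonneg_right (hoccle T hT j) (abs_nonneg _))
    refine h1.congr' ?_
    filter_upwards [eventually_gt_atTop 0] with T hT
    exact (hswap _ hf T hT).tsum_eq

/-! ### Changes of actions, balance relations, and feasibility. -/

theorem sum_add_single_mul (v : Fin K → ℕ) (k : Fin K) (b : ℕ) (x : Fin K → ℝ) :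
    ∑ j, (((v + Pi.single k b : Fin K → ℕ) j : ℕ) : ℝ) * x j = ∑ j, (v j : ℝ) * x j + b * x k := by
  simp only [Pi.add_apply, Nat.cast_add, add_mul, Finset.sum_add_distrib]
  congr 1
  rw [Finset.sum_eq_single k]
  · simp
  · intro j _ hj
    simp [hj]
  · simp

theorem serviceRate_add_single (v : Fin K → ℕ) (k : Fin K) (b : ℕ) :
    Q.serviceRate (v + Pi.single k b) = Q.serviceRate v + b * Q.mu k :=
  sum_add_single_mul v k b Q.mu

/-- Sum the cut equations: total flow down equals total flow up, whatever the policy. -/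
theorem hasSum_weight_mul_serviceRate (hd : d ∈ Q.efficientPolicies) {β : ℕ → ℝ} {B : ℝ}
    (hbal : ∀ n, Q.lam * β n = Q.serviceRate (d (n + 1)) * β (n + 1)) (hsum : HasSum β B) :
    HasSum (fun n => β n * Q.serviceRate (d n)) (Q.lam * B) := by
  have h : HasSum (fun n => β (n + 1) * Q.serviceRate (d (n + 1))) (Q.lam * B) := by
    simpa only [hbal, mul_comm] using hsum.mul_left Q.lam
  have := (hasSum_nat_add_iff (f := fun n => β n * Q.serviceRate (d n)) 1).1 h
  simpa [serviceRate_zero hd] using this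

/-- Arrivals never stop, so positivity moves upward; downward it may fail where no server works. -/
theorem pos_of_le_of_balance (hQ : Q.Standing) {β : ℕ → ℝ} (hβ : ∀ n, 0 ≤ β n)
    (hbal : ∀ n, Q.lam * β n = Q.serviceRate (d (n + 1)) * β (n + 1)) {m : ℕ} (hm : 0 < β m) :
    ∀ n, m ≤ n → 0 < β n := by
  intro n hn
  induction n, hn using Nat.le_induction with
  | base => exact hm
  | succ n _ ih =>
    refine (hβ (n + 1)).lt_of_ne fun h => ?_
    have := hbal n
    rw [← h, mul_zero] at this
    exact (mul_pos hQ.lam_pos ih).ne' this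

theorem serviceRate_pos_of_pos (hQ : Q.Standing) {β : ℕ → ℝ} {n : ℕ}
    (hbal : Q.lam * β n = Q.serviceRate (d (n + 1)) * β (n + 1)) (h : 0 < β n)
    (h' : 0 < β (n + 1)) : 0 < Q.serviceRate (d (n + 1)) := by
  refine pos_of_mul_pos_left ?_ h'.le
  rw [← hbal]
  exact mul_pos hQ.lam_pos h

theorem thresholdPolicy_mem (θ : Fin K → ℕ) : Q.thresholdPolicy θ ∈ Q.efficientPolicies := by
  intro n
  refine ⟨fun k => ?_, ?_⟩
  · rw [thresholdPolicy_eq]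
    split_ifs
    · exact min_le_left _ _
    · exact Nat.zero_le _
  -- Adding groups in increasing order keeps the partial sum below the one over `Finset.Iio k`,
  -- which the policy leaves room for.
  · refine Finset.induction_on_max Finset.univ (motive := fun s => ∑ k ∈ s, Q.thresholdPolicy θ n k ≤ n)
      (by simp) fun k s hs ih => ?_
    have h1 : ∑ l ∈ s, Q.thresholdPolicy θ n l ≤ ∑ l ∈ Finset.Iio k, Q.thresholdPolicy θ n l :=
      Finset.sum_le_sum_of_subset fun l hl => Finset.mem_Iio.2 (hs l hl)
    have h2 : Q.thresholdPolicy θ n k ≤ n - ∑ l ∈ Finset.Iio k, Q.thresholdPolicy θ n l := by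
      rw [thresholdPolicy_eq]
      split_ifs
      · exact min_le_right _ _
      · exact Nat.zero_le _
    rw [Finset.sum_insert fun h => (hs k h).false]
    omega

/-! ### The reduced cost. -/

variable [NeZero K]

/-- The cost rate when every unit of service rate is refunded at the price of group `0`. -/
def reducedCost (Q : GroupQueue K) (n : ℕ) (m : Fin K → ℕ) : ℝ :=
  Q.h n + ∑ k, (m k : ℝ) * (Q.c k - Q.c 0 / Q.mu 0 * Q.mu k)

theorem cost_eq_reducedCost (n : ℕ) (m : Fin K → ℕ) :
    Q.cost n m = Q.reducedCost n m + Q.c 0 / Q.mu 0 * Q.serviceRate m := by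
  rw [cost, reducedCost, serviceRate, Finset.mul_sum, add_assoc, ← Finset.sum_add_distrib]
  congr 1
  exact Finset.sum_congr rfl fun k _ => by ring

theorem excess_nonneg (hQ : Q.Standing) (hS : Q.ScaleEconomies) (k : Fin K) :
    0 ≤ Q.c k - Q.c 0 / Q.mu 0 * Q.mu k := by
  have h : Q.c 0 / Q.mu 0 ≤ Q.c k / Q.mu k := hS.ratio_mono (Fin.zero_le k)
  rw [le_div_iff₀ (hQ.mu_pos k)] at h
  linarith

theorem excess_zero (hQ : Q.Standing) : Q.c 0 - Q.c 0 / Q.mu 0 * Q.mu 0 = 0 := by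
  rw [div_mul_cancel₀ _ (hQ.mu_pos 0).ne', sub_self]

theorem le_reducedCost (hQ : Q.Standing) (hS : Q.ScaleEconomies) (n : ℕ) (m : Fin K → ℕ) :
    Q.h n ≤ Q.reducedCost n m :=
  le_add_of_nonneg_right (Finset.sum_nonneg fun k _ =>
    mul_nonneg (Nat.cast_nonneg _) (excess_nonneg hQ hS k))

theorem reducedCost_add_single (n : ℕ) (v : Fin K → ℕ) (k : Fin K) (b : ℕ) :
    Q.reducedCost n (v + Pi.single k b) =
      Q.reducedCost n v + b * (Q.c k - Q.c 0 / Q.mu 0 * Q.mu k) := by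
  rw [reducedCost, reducedCost, sum_add_single_mul, add_assoc]

theorem reducedCost_single_zero (hQ : Q.Standing) (n b : ℕ) :
    Q.reducedCost n (Pi.single 0 b) = Q.h n := by
  have := reducedCost_add_single (Q := Q) n 0 0 b
  rw [zero_add, excess_zero hQ, mul_zero, add_zero] at this
  rw [this]
  simp [reducedCost]

theorem serviceRate_single_zero (b : ℕ) :
    Q.serviceRate (Pi.single 0 b) = b * Q.mu 0 := by
  have := serviceRate_add_single (Q := Q) 0 0 b
  rw [zero_add] at this
  rw [this]
  simp [serviceRate]

theorem IsStationary.hasSum_reducedCost (hd : d ∈ Q.efficientPolicies) {α : ℕ → ℝ}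
    (hα : Q.IsStationary d α) :
    HasSum (fun n => α n * Q.reducedCost n (d n))
      (∑' n, α n * Q.cost n (d n) - Q.c 0 / Q.mu 0 * Q.lam) := by
  have h := hα.summable_cost.hasSum.sub
    ((hasSum_weight_mul_serviceRate hd hα.balance hα.hasSum_one).mul_left (Q.c 0 / Q.mu 0))
  rw [mul_one] at h
  refine h.congr_fun fun n => ?_
  rw [cost_eq_reducedCost]
  ring

/-- The average cost in terms of an unnormalized stationary measure and the reduced cost. -/
theorem hasAverageCost_of_weight (hQ : Q.Standing) (hd : d ∈ Q.efficientPolicies) {β : ℕ → ℝ}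
    {B C : ℝ} (hpos : ∀ n, 0 < β n)
    (hbal : ∀ n, Q.lam * β n = Q.serviceRate (d (n + 1)) * β (n + 1)) (hB : HasSum β B)
    (hC : HasSum (fun n => β n * Q.reducedCost n (d n)) C) :
    Q.HasAverageCost d (C / B + Q.c 0 / Q.mu 0 * Q.lam) := by
  have hB0 : 0 < B := by
    rw [← hB.tsum_eq]
    exact hB.summable.tsum_pos (fun n => (hpos n).le) 0 (hpos 0)
  have hcost : HasSum (fun n => β n / B * Q.cost n (d n)) (C / B + Q.c 0 / Q.mu 0 * Q.lam) := by
    have h := (hC.add ((hasSum_weight_mul_serviceRate hd hbal hB).mul_left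
      (Q.c 0 / Q.mu 0))).div_const B
    rw [add_div, ← mul_assoc, mul_div_cancel_right₀ _ hB0.ne'] at h
    refine h.congr_fun fun n => ?_
    rw [cost_eq_reducedCost]
    ring
  have hst : Q.IsStationary d fun n => β n / B :=
    { nonneg := fun n => (div_pos (hpos n) hB0).le
      balance := fun n => by rw [← mul_div_assoc, ← mul_div_assoc, hbal]
      hasSum_one := by simpa [div_self hB0.ne'] using hB.div_const B
      summable_cost := hcost.summable }
  rw [← hcost.tsum_eq]
  exact hst.hasAverageCost hQ hd fun n => div_pos (hpos n) hB0

/-- Strictness comes from `h` tending to infinity: some `N > m` of positive weight has `h N > h m`.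
State `m` itself cannot supply it, its reduced cost being replaced by `h m`. -/
theorem h_mul_tail_lt (hQ : Q.Standing) (hS : Q.ScaleEconomies) {α : ℕ → ℝ} {m : ℕ}
    (hm : ∀ n, m ≤ n → 0 < α n) {B C : ℝ} (hB : HasSum (fun n => α (n + m)) B)
    (hC : HasSum (fun n => α (n + m) * Q.reducedCost (n + m) (d (n + m))) C) :
    Q.h m * B < C - α m * (Q.reducedCost m (d m) - Q.h m) := by
  obtain ⟨N, hN⟩ := ((hQ.h_tendsto.eventually_gt_atTop (Q.h m)).and
    (eventually_gt_atTop m)).exists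
  have h2 := hC.sub (hasSum_ite_eq 0 (α m * (Q.reducedCost m (d m) - Q.h m)))
  have hle : ∀ n, α (n + m) * Q.h m ≤ α (n + m) * Q.reducedCost (n + m) (d (n + m)) :=
    fun n => mul_le_mul_of_nonneg_left ((hQ.h_mono (Nat.le_add_left m n)).trans
      (le_reducedCost hQ hS _ _)) (hm _ (Nat.le_add_left m n)).le
  rw [mul_comm]
  refine hasSum_lt (i := N - m) (fun n => ?_) ?_ (hB.mul_right (Q.h m)) h2
  · change α (n + m) * Q.h m ≤ α (n + m) * Q.reducedCost (n + m) (d (n + m)) -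
      if n = 0 then α m * (Q.reducedCost m (d m) - Q.h m) else 0
    rcases eq_or_ne n 0 with rfl | hn
    · rw [if_pos rfl, Nat.zero_add]
      linarith
    · rw [if_neg hn, sub_zero]
      exact hle n
  · change α (N - m + m) * Q.h m < α (N - m + m) * Q.reducedCost (N - m + m) (d (N - m + m)) -
      if N - m = 0 then α m * (Q.reducedCost m (d m) - Q.h m) else 0
    rw [if_neg (by omega), sub_zero, Nat.sub_add_cancel hN.2.le]
    exact mul_lt_mul_of_pos_left (hN.1.trans_le (le_reducedCost hQ hS _ _)) (hm N hN.2.le)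

/-! ### Two ways to improve a policy. -/

/-- The policy that up to state `m` uses group `0` only, as much as possible, and agrees with `d`
above `m`. -/
def boost (Q : GroupQueue K) (d : Policy K) (m : ℕ) : Policy K := fun n =>
  if n ≤ m then Pi.single 0 (min (Q.M 0) n) else d n

theorem boost_of_le {m n : ℕ} (h : n ≤ m) :
    Q.boost d m n = Pi.single 0 (min (Q.M 0) n) := if_pos h

theorem boost_of_lt {m n : ℕ} (h : m < n) : Q.boost d m n = d n := if_neg h.not_ge

theorem boost_mem (hd : d ∈ Q.efficientPolicies) (m : ℕ) :
    Q.boost d m ∈ Q.efficientPolicies := by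
  intro n
  rcases le_or_gt n m with h | h
  · rw [boost_of_le h]
    refine ⟨fun k => ?_, ?_⟩
    · rcases eq_or_ne k 0 with rfl | hk
      · simp
      · simp [hk]
    · rw [Finset.sum_pi_single' 0 _ Finset.univ]
      simp
  · rw [boost_of_lt h]
    exact hd n

/-- If the mean of the reduced cost rate over the states from `m` on is at most its overall mean,
then the policy `boost d m` is strictly better than `d`. -/
theorem IsStationary.exists_boost_lt (hQ : Q.Standing) (hS : Q.ScaleEconomies)
    (hd : d ∈ Q.efficientPolicies) {α : ℕ → ℝ} (hα : Q.IsStationary d α) {m : ℕ} (hm : 1 ≤ m)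
    (hαm : 0 < α m) {B C : ℝ} (hB : HasSum (fun n => α (n + m)) B)
    (hC : HasSum (fun n => α (n + m) * Q.reducedCost (n + m) (d (n + m))) C)
    (hle : C ≤ (∑' n, α n * Q.cost n (d n) - Q.c 0 / Q.mu 0 * Q.lam) * B) :
    ∃ a < ∑' n, α n * Q.cost n (d n), Q.HasAverageCost (Q.boost d m) a := by
  have hpos := pos_of_le_of_balance hQ hα.nonneg hα.balance hαm
  have hs : ∀ n < m, 0 < Q.serviceRate (Q.boost d m (n + 1)) := fun n hn => by
    rw [boost_of_le (Nat.succ_le_of_lt hn), serviceRate_single_zero]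
    have h1 : 0 < min (Q.M 0) (n + 1) := lt_min (hQ.M_pos 0) n.succ_pos
    exact mul_pos (Nat.cast_pos.2 h1) (hQ.mu_pos 0)
  -- The weights from `m` on are kept and extended downward by detailed balance; normalization waits
  -- until the end.
  set β : ℕ → ℝ := fun n => if n < m then
    α m * ∏ j ∈ Finset.Ico n m, (Q.serviceRate (Q.boost d m (j + 1)) / Q.lam) else α n with hβ
  have hβlt : ∀ n < m, β n =
      α m * ∏ j ∈ Finset.Ico n m, (Q.serviceRate (Q.boost d m (j + 1)) / Q.lam) :=
    fun n hn => if_pos hn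
  have hβge : ∀ n, m ≤ n → β n = α n := fun n hn => if_neg hn.not_gt
  have hβpos : ∀ n, 0 < β n := fun n => by
    rcases lt_or_ge n m with h | h
    · rw [hβlt n h]
      exact mul_pos hαm (Finset.prod_pos fun j hj =>
        div_pos (hs j (Finset.mem_Ico.1 hj).2) hQ.lam_pos)
    · rw [hβge n h]
      exact hpos n h
  have hβbal : ∀ n, Q.lam * β n = Q.serviceRate (Q.boost d m (n + 1)) * β (n + 1) := fun n => by
    rcases lt_or_ge n m with h | h
    · have hprod : β (n + 1) =
          α m * ∏ j ∈ Finset.Ico (n + 1) m, (Q.serviceRate (Q.boost d m (j + 1)) / Q.lam) := by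
        rcases (Nat.succ_le_of_lt h).lt_or_eq with h' | h'
        · exact hβlt _ h'
        · rw [hβge _ h'.ge, ← h', Nat.succ_eq_add_one, Finset.Ico_self, Finset.prod_empty, mul_one]
      rw [hprod, hβlt n h, Finset.prod_eq_prod_Ico_succ_bot h]
      have := hQ.lam_pos.ne'
      field_simp
    · rw [hβge n h, hβge (n + 1) (by omega), boost_of_lt (by omega)]
      exact hα.balance n
  have hβB : HasSum β (B + ∑ n ∈ Finset.range m, β n) := by
    refine (hasSum_nat_add_iff (f := β) m).1 ?_
    simpa only [hβge _ (Nat.le_add_left m _)] using hB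
  have hβC : HasSum (fun n => β n * Q.reducedCost n (Q.boost d m n))
      (C - α m * (Q.reducedCost m (d m) - Q.h m) + ∑ n ∈ Finset.range m, β n * Q.h n) := by
    have hhead : ∑ n ∈ Finset.range m, β n * Q.h n
        = ∑ n ∈ Finset.range m, β n * Q.reducedCost n (Q.boost d m n) :=
      Finset.sum_congr rfl fun n hn => by
        rw [boost_of_le (Finset.mem_range.1 hn).le, reducedCost_single_zero hQ]
    rw [hhead]
    refine (hasSum_nat_add_iff (f := fun n => β n * Q.reducedCost n (Q.boost d m n)) m).1 ?_
    refine (hC.sub (hasSum_ite_eq 0 (α m * (Q.reducedCost m (d m) - Q.h m)))).congr_fun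
      fun n => ?_
    change β (n + m) * Q.reducedCost (n + m) (Q.boost d m (n + m)) =
      α (n + m) * Q.reducedCost (n + m) (d (n + m)) -
        if n = 0 then α m * (Q.reducedCost m (d m) - Q.h m) else 0
    rw [hβge _ (Nat.le_add_left m n)]
    rcases eq_or_ne n 0 with rfl | hn
    · rw [if_pos rfl, Nat.zero_add, boost_of_le le_rfl, reducedCost_single_zero hQ]
      ring
    · rw [if_neg hn, sub_zero, boost_of_lt (by omega)]
  have hlt := h_mul_tail_lt hQ hS hpos hB hC
  have hδ : 0 ≤ α m * (Q.reducedCost m (d m) - Q.h m) :=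
    mul_nonneg hαm.le (sub_nonneg.2 (le_reducedCost hQ hS _ _))
  have hB0 : 0 < B := by
    rw [← hB.tsum_eq]
    exact hB.summable.tsum_pos (fun n => hα.nonneg _) 0 (by simpa using hαm)
  set r := ∑' n, α n * Q.cost n (d n) - Q.c 0 / Q.mu 0 * Q.lam
  -- `h m` is below the tail mean, which by assumption is at most `r`.
  have hr : Q.h m < r := lt_of_mul_lt_mul_right (by linarith) hB0.le
  have hA : 0 < ∑ n ∈ Finset.range m, β n :=
    Finset.sum_pos (fun n _ => hβpos n) ⟨0, Finset.mem_range.2 hm⟩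
  have hAC : ∑ n ∈ Finset.range m, β n * Q.h n ≤ Q.h m * ∑ n ∈ Finset.range m, β n := by
    rw [mul_comm, Finset.sum_mul]
    exact Finset.sum_le_sum fun n hn =>
      mul_le_mul_of_nonneg_left (hQ.h_mono (Finset.mem_range.1 hn).le) (hβpos n).le
  refine ⟨_, ?_, hasAverageCost_of_weight hQ (boost_mem hd m) hβpos hβbal hβB hβC⟩
  rw [← lt_sub_iff_add_lt, div_lt_iff₀ (by positivity)]
  change _ < r * _
  have := mul_lt_mul_of_pos_right hr hA
  linarith

/-- If the mean of the reduced cost rate over the states from `m` on exceeds its overall mean,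
then an action in state `m` with at least the same service rate and at most the same reduced cost,
one of them strictly, makes the policy strictly better. -/
theorem IsStationary.exists_update_lt (hQ : Q.Standing)
    (hd : d ∈ Q.efficientPolicies) {α : ℕ → ℝ} (hα : Q.IsStationary d α) (hpos : ∀ n, 0 < α n)
    {m : ℕ} (hm : 1 ≤ m) {B C : ℝ} (hB : HasSum (fun n => α (n + m)) B)
    (hC : HasSum (fun n => α (n + m) * Q.reducedCost (n + m) (d (n + m))) C)
    (hlt : (∑' n, α n * Q.cost n (d n) - Q.c 0 / Q.mu 0 * Q.lam) * B < C)
    {u : Fin K → ℕ} (hu : Function.update d m u ∈ Q.efficientPolicies)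
    (hs : Q.serviceRate (d m) ≤ Q.serviceRate u)
    (hc : Q.reducedCost m u ≤ Q.reducedCost m (d m))
    (hsc : Q.serviceRate (d m) < Q.serviceRate u ∨ Q.reducedCost m u < Q.reducedCost m (d m)) :
    ∃ a < ∑' n, α n * Q.cost n (d n), Q.HasAverageCost (Function.update d m u) a := by
  obtain ⟨p, rfl⟩ : ∃ p, m = p + 1 := ⟨m - 1, by omega⟩
  set m := p + 1
  have hsm : 0 < Q.serviceRate (d m) :=
    serviceRate_pos_of_pos hQ (hα.balance p) (hpos p) (hpos _)
  have hsu : 0 < Q.serviceRate u := hsm.trans_le hs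
  -- Only the rate in `m` changes, so balance scales all weights from `m` on by this one factor.
  set ρ := Q.serviceRate (d m) / Q.serviceRate u with hρ
  have hρ0 : 0 < ρ := div_pos hsm hsu
  have hρs : Q.serviceRate u * ρ = Q.serviceRate (d m) := mul_div_cancel₀ _ hsu.ne'
  set β : ℕ → ℝ := fun n => if n < m then α n else ρ * α n
  have hβlt : ∀ n < m, β n = α n := fun n hn => if_pos hn
  have hβge : ∀ n, m ≤ n → β n = ρ * α n := fun n hn => if_neg hn.not_gt
  have hβpos : ∀ n, 0 < β n := fun n => by
    rcases lt_or_ge n m with h | h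
    · rw [hβlt n h]; exact hpos n
    · rw [hβge n h]; exact mul_pos hρ0 (hpos n)
  have hβbal : ∀ n, Q.lam * β n =
      Q.serviceRate (Function.update d m u (n + 1)) * β (n + 1) := fun n => by
    rcases lt_trichotomy (n + 1) m with h | h | h
    · rw [hβlt n (by omega), hβlt _ h, Function.update_of_ne h.ne]
      exact hα.balance n
    · rw [hβlt n (by omega), hβge _ h.ge, h, Function.update_self, ← mul_assoc, hρs, hα.balance, h]
    · rw [hβge n (by omega), hβge _ h.le, Function.update_of_ne h.ne', mul_left_comm,
        hα.balance n]
      ring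
  have hβB : HasSum β (ρ * B + ∑ n ∈ Finset.range m, α n) := by
    have hhead : ∑ n ∈ Finset.range m, α n = ∑ n ∈ Finset.range m, β n :=
      Finset.sum_congr rfl fun n hn => (hβlt n (Finset.mem_range.1 hn)).symm
    rw [hhead]
    refine (hasSum_nat_add_iff (f := β) m).1 ?_
    simpa only [hβge _ (Nat.le_add_left m _)] using hB.mul_left ρ
  have hβC : HasSum (fun n => β n * Q.reducedCost n (Function.update d m u n))
      (ρ * (C - α m * (Q.reducedCost m (d m) - Q.reducedCost m u))
        + ∑ n ∈ Finset.range m, α n * Q.reducedCost n (d n)) := by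
    have hhead : ∑ n ∈ Finset.range m, α n * Q.reducedCost n (d n)
        = ∑ n ∈ Finset.range m, β n * Q.reducedCost n (Function.update d m u n) :=
      Finset.sum_congr rfl fun n hn => by
        rw [hβlt n (Finset.mem_range.1 hn), Function.update_of_ne (Finset.mem_range.1 hn).ne]
    rw [hhead]
    refine (hasSum_nat_add_iff
      (f := fun n => β n * Q.reducedCost n (Function.update d m u n)) m).1 ?_
    refine ((hC.sub (hasSum_ite_eq 0
      (α m * (Q.reducedCost m (d m) - Q.reducedCost m u)))).mul_left ρ).congr_fun fun n => ?_
    change β (n + m) * Q.reducedCost (n + m) (Function.update d m u (n + m)) =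
      ρ * (α (n + m) * Q.reducedCost (n + m) (d (n + m)) -
        if n = 0 then α m * (Q.reducedCost m (d m) - Q.reducedCost m u) else 0)
    rw [hβge _ (Nat.le_add_left m n)]
    rcases eq_or_ne n 0 with rfl | hn
    · rw [if_pos rfl, Nat.zero_add, Function.update_self]
      ring
    · rw [if_neg hn, sub_zero, Function.update_of_ne (by omega)]
      ring
  have hr := hα.hasSum_reducedCost hd
  set r := ∑' n, α n * Q.cost n (d n) - Q.c 0 / Q.mu 0 * Q.lam
  have hsumB : B + ∑ n ∈ Finset.range m, α n = 1 :=
    ((hasSum_nat_add_iff (f := α) m).1 hB).unique hα.hasSum_one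
  have hsumC : C + ∑ n ∈ Finset.range m, α n * Q.reducedCost n (d n) = r :=
    ((hasSum_nat_add_iff (f := fun n => α n * Q.reducedCost n (d n)) m).1 hC).unique hr
  have hB0 : 0 < B := by
    rw [← hB.tsum_eq]
    exact hB.summable.tsum_pos (fun n => hα.nonneg _) 0 (hpos _)
  have hA : 0 < ∑ n ∈ Finset.range m, α n :=
    Finset.sum_pos (fun n _ => hpos n) ⟨0, Finset.mem_range.2 hm⟩
  refine ⟨_, ?_, hasAverageCost_of_weight hQ hu hβpos hβbal hβB hβC⟩
  rw [← lt_sub_iff_add_lt, div_lt_iff₀ (by positivity)]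
  change _ < r * _
  have hρ1 : ρ ≤ 1 := (div_le_one hsu).2 hs
  -- This is `r` times the new total mass minus the new total reduced cost: the gain from a lighter
  -- tail plus the saving in state `m`.
  have hgap : 0 < (1 - ρ) * (C - r * B)
      + ρ * (α m * (Q.reducedCost m (d m) - Q.reducedCost m u)) := by
    have h1 : 0 ≤ (1 - ρ) * (C - r * B) := mul_nonneg (by linarith) (by linarith)
    have h2 : 0 ≤ ρ * (α m * (Q.reducedCost m (d m) - Q.reducedCost m u)) :=
      mul_nonneg hρ0.le (mul_nonneg (hpos m).le (by linarith))
    rcases hsc with h | h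
    · have : ρ < 1 := (div_lt_one hsu).2 h
      have : 0 < (1 - ρ) * (C - r * B) := mul_pos (by linarith) (by linarith)
      linarith
    · have : 0 < ρ * (α m * (Q.reducedCost m (d m) - Q.reducedCost m u)) :=
        mul_pos hρ0 (mul_pos (hpos m) (by linarith))
      linarith
  have hA' : ∑ n ∈ Finset.range m, α n = 1 - B := by linarith
  have hAC : ∑ n ∈ Finset.range m, α n * Q.reducedCost n (d n) = r - C := by linarith
  rw [hA', hAC]
  linarith

/-- A stationary distribution of a policy that no policy `boost d m` improves charges every state. -/
theorem IsStationary.pos_of_forall_boost (hQ : Q.Standing) (hS : Q.ScaleEconomies)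
    (hd : d ∈ Q.efficientPolicies) {α : ℕ → ℝ} (hα : Q.IsStationary d α)
    (hopt : ∀ m, ∀ a, Q.HasAverageCost (Q.boost d m) a → ∑' n, α n * Q.cost n (d n) ≤ a) (n : ℕ) :
    0 < α n := by
  have hex : ∃ m, 0 < α m := by
    by_contra! h
    have h0 : α = 0 := funext fun n => le_antisymm (h n) (hα.nonneg n)
    have := hα.hasSum_one
    rw [h0] at this
    exact zero_ne_one (hasSum_zero.unique this)
  classical
  have hm := Nat.find_spec hex
  have hmin : ∀ n < Nat.find hex, α n = 0 := fun n hn =>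
    le_antisymm (not_lt.1 (Nat.find_min hex hn)) (hα.nonneg n)
  set m := Nat.find hex
  rcases Nat.eq_zero_or_pos m with h0 | h0
  · rw [h0] at hm
    exact pos_of_le_of_balance hQ hα.nonneg hα.balance hm n (Nat.zero_le n)
  -- With no mass below `m > 0`, the tail mean equals the overall mean, the equality case of
  -- `exists_boost_lt`.
  · exfalso
    have hB : HasSum (fun n => α (n + m)) 1 := by
      refine (hasSum_nat_add_iff (f := α) m).2 ?_
      rw [Finset.sum_eq_zero fun n hn => hmin n (Finset.mem_range.1 hn), add_zero]
      exact hα.hasSum_one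
    have hC : HasSum (fun n => α (n + m) * Q.reducedCost (n + m) (d (n + m)))
        (∑' n, α n * Q.cost n (d n) - Q.c 0 / Q.mu 0 * Q.lam) := by
      refine (hasSum_nat_add_iff (f := fun n => α n * Q.reducedCost n (d n)) m).2 ?_
      rw [Finset.sum_eq_zero fun n hn => by rw [hmin n (Finset.mem_range.1 hn), zero_mul],
        add_zero]
      exact hα.hasSum_reducedCost hd
    obtain ⟨a, ha, ha'⟩ := hα.exists_boost_lt hQ hS hd h0 hm hB hC (by rw [mul_one])
    exact ha.not_ge (hopt m a ha')

/-! ### Optimal policies and their potentials. -/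

theorem IsOptimal.exists_isStationary_pos (hQ : Q.Standing) (hS : Q.ScaleEconomies)
    (hd : Q.IsOptimal d) :
    ∃ α, Q.IsStationary d α ∧ (∀ n, 0 < α n) ∧
      ∀ d' ∈ Q.efficientPolicies, ∀ a, Q.HasAverageCost d' a → ∑' n, α n * Q.cost n (d n) ≤ a := by
  obtain ⟨hd, a, ha, hmin⟩ := hd
  obtain ⟨α, hα, hle⟩ := ha.exists_isStationary hQ hd
  refine ⟨α, hα, hα.pos_of_forall_boost hQ hS hd fun m a' ha' =>
    hle.trans (hmin _ (boost_mem hd m) a' ha'), fun d' hd' a' ha' => hle.trans (hmin d' hd' a' ha')⟩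

theorem IsOptimal.group_zero_eq (hQ : Q.Standing) (hS : Q.ScaleEconomies) (hopt : Q.IsOptimal d)
    {n : ℕ} (hn : 1 ≤ n) : d n 0 = min (Q.M 0) n := by
  have hd := hopt.1
  obtain ⟨α, hα, hpos, hmin⟩ := hopt.exists_isStationary_pos hQ hS
  have hB := ((summable_nat_add_iff (f := α) n).2 hα.hasSum_one.summable).hasSum
  have hC := ((summable_nat_add_iff (f := fun j => α j * Q.reducedCost j (d j)) n).2
    (hα.hasSum_reducedCost hd).summable).hasSum
  -- Every tail of an optimal policy is expensive, since otherwise `boost` would improve it.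
  have hlt : (∑' n, α n * Q.cost n (d n) - Q.c 0 / Q.mu 0 * Q.lam) * ∑' j, α (j + n)
      < ∑' j, α (j + n) * Q.reducedCost (j + n) (d (j + n)) := by
    by_contra! hle
    obtain ⟨a, ha, ha'⟩ := hα.exists_boost_lt hQ hS hd hn (hpos n) hB hC hle
    exact ha.not_ge (hmin _ (boost_mem hd n) a ha')
  by_contra hne
  have hM := (hd n).1 0
  have h0n : d n 0 ≤ n :=
    (Finset.single_le_sum (fun k _ => Nat.zero_le (d n k)) (Finset.mem_univ 0)).trans (hd n).2
  have hlt' : d n 0 < min (Q.M 0) n := lt_of_le_of_ne (le_min hM h0n) hne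
  have hu : ∀ u : Fin K → ℕ, (∀ k, u k ≤ Q.M k) → ∑ k, u k ≤ n →
      Function.update d n u ∈ Q.efficientPolicies := fun u h1 h2 j => by
    rcases eq_or_ne j n with rfl | hj
    · rw [Function.update_self]
      exact ⟨h1, h2⟩
    · rw [Function.update_of_ne hj]
      exact hd j
  suffices ∃ u : Fin K → ℕ, (∀ k, u k ≤ Q.M k) ∧ ∑ k, u k ≤ n ∧
      Q.serviceRate (d n) ≤ Q.serviceRate u ∧ Q.reducedCost n u ≤ Q.reducedCost n (d n) ∧
      (Q.serviceRate (d n) < Q.serviceRate u ∨ Q.reducedCost n u < Q.reducedCost n (d n)) by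
    obtain ⟨u, h1, h2, h3, h4, h5⟩ := this
    obtain ⟨a, ha, ha'⟩ := hα.exists_update_lt hQ hd hpos hn hB hC hlt (hu u h1 h2) h3 h4 h5
    exact ha.not_ge (hmin _ (hu u h1 h2) a ha')
  have hμ0 := hQ.mu_pos 0
  have hexc0 := excess_zero hQ
  -- If a customer is unserved, one more server of group 0 is switched on; otherwise it replaces a
  -- server of another group.
  rcases (hd n).2.lt_or_eq with hsum | hsum
  · refine ⟨d n + Pi.single 0 1, fun k => ?_, ?_, ?_, ?_, Or.inl ?_⟩
    · rcases eq_or_ne k 0 with rfl | hk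
      · simpa using Nat.succ_le_of_lt (hlt'.trans_le (min_le_left _ _))
      · simpa [hk] using (hd n).1 k
    · simp only [Pi.add_apply, Finset.sum_add_distrib, Finset.sum_pi_single' _ _ Finset.univ]
      simpa using hsum
    · rw [serviceRate_add_single]
      push_cast
      linarith
    · rw [reducedCost_add_single, hexc0, mul_zero, add_zero]
    · rw [serviceRate_add_single]
      push_cast
      linarith
  · obtain ⟨k, hk0, hk⟩ : ∃ k, k ≠ 0 ∧ 0 < d n k := by
      by_contra! h
      have : ∑ k, d n k = d n 0 :=
        Finset.sum_eq_single 0 (fun k _ hk => Nat.le_zero.1 (h k hk)) (by simp)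
      have := hlt'.trans_le (min_le_right _ _)
      omega
    have hv : (d n - Pi.single k 1) + Pi.single k 1 = d n := by
      funext j
      rcases eq_or_ne j k with rfl | hj
      · simp [Nat.sub_add_cancel hk]
      · simp [hj]
    have hexc := excess_nonneg hQ hS k
    have hμ : Q.mu k ≤ Q.mu 0 := hS.mu_anti (Fin.zero_le k)
    set v := d n - Pi.single k 1 with hvdef
    have hvle : ∀ j, v j ≤ d n j := fun j => Nat.sub_le _ _
    have hsv : Q.serviceRate (d n) = Q.serviceRate v + Q.mu k := by
      rw [← hv, serviceRate_add_single, Nat.cast_one, one_mul]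
    have hcv : Q.reducedCost n (d n) =
        Q.reducedCost n v + (Q.c k - Q.c 0 / Q.mu 0 * Q.mu k) := by
      rw [← hv, reducedCost_add_single, Nat.cast_one, one_mul]
    have hsu : Q.serviceRate (v + Pi.single 0 1) = Q.serviceRate v + Q.mu 0 := by
      rw [serviceRate_add_single, Nat.cast_one, one_mul]
    have hcu : Q.reducedCost n (v + Pi.single 0 1) = Q.reducedCost n v := by
      rw [reducedCost_add_single, hexc0, mul_zero, add_zero]
    refine ⟨v + Pi.single 0 1, fun j => ?_, ?_, ?_, ?_, ?_⟩
    · rcases eq_or_ne j 0 with rfl | hj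
      · have h1 := hvle 0
        have h2 := hlt'.trans_le (min_le_left _ _)
        simp only [Pi.add_apply, Pi.single_eq_same]
        omega
      · simpa [hj] using (hvle j).trans ((hd n).1 j)
    · have h1 : ∑ j, (v + Pi.single k 1 : Fin K → ℕ) j = n := by rw [hv]; exact hsum
      simp only [Pi.add_apply, Finset.sum_add_distrib, Finset.sum_pi_single' _ _ Finset.univ]
        at h1 ⊢
      simp only [Finset.mem_univ, if_true] at h1 ⊢
      exact h1.le
    · rw [hsv, hsu]
      linarith
    · rw [hcv, hcu]
      linarith
    · rw [hsv, hsu, hcv, hcu]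
      -- Equality in both rate and reduced cost would make group `k` identical to group 0.
      by_contra! h
      have h1 : Q.mu k = Q.mu 0 := by linarith [h.1]
      have h2 : Q.c k = Q.c 0 := by
        have := h.2
        rw [h1, div_mul_cancel₀ _ hμ0.ne'] at this
        rw [h1, div_mul_cancel₀ _ hμ0.ne'] at hexc
        linarith
      exact hk0 (hQ.heterogeneous (by simp only [h1, h2]))

/-- In state 0 the Poisson equation reads `a = h 0 + lam * (g 1 - g 0)`, while `a` is at least `c 0
/ mu 0 * lam` plus a mean reduced cost exceeding `h 0`. -/
theorem IsOptimal.lt_potential_diff (hQ : Q.Standing) (hS : Q.ScaleEconomies)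
    (hopt : Q.IsOptimal d) {a : ℝ} (ha : Q.HasAverageCost d a) {g : ℕ → ℝ}
    (hg : Q.IsPotential d a g) : Q.c 0 / Q.mu 0 < g 1 - g 0 := by
  have hd := hopt.1
  obtain ⟨α, hα, hpos, hmin⟩ := hopt.exists_isStationary_pos hQ hS
  have h1 := h_mul_tail_lt hQ hS (m := 0) (fun n _ => hpos n) (B := 1) hα.hasSum_one
    (hα.hasSum_reducedCost hd)
  have h2 : Q.reducedCost 0 (d 0) = Q.h 0 := by simp [reducedCost, efficient_zero hd]
  have h3 := hmin d hd a ha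
  have h4 := hg 0
  rw [gen_apply, cost_eq_reducedCost, h2, serviceRate_zero hd] at h4
  rw [h2] at h1
  refine lt_of_mul_lt_mul_right ?_ hQ.lam_pos.le
  simp only [zero_add] at h4
  linarith

/-! ### Threshold policies. -/

theorem thresholdPolicy_zero (θ : Fin K → ℕ) (n : ℕ) :
    Q.thresholdPolicy θ n 0 = if θ 0 ≤ n then min (Q.M 0) n else 0 := by
  have h : Finset.Iio (0 : Fin K) = ∅ := by
    ext l
    simp
  rw [thresholdPolicy_eq, h, Finset.sum_empty, Nat.sub_zero]

/-- By monotonicity every group is off below `θ 0`, so there lowering the first threshold switches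
on group 0 alone; from `θ 0` on nothing changes. -/
theorem boost_thresholdPolicy {θ : Fin K → ℕ} (hθ : Monotone θ) (h2 : 1 < θ 0) :
    Q.boost (Q.thresholdPolicy θ) (θ 0 - 1) = Q.thresholdPolicy (Function.update θ 0 1) := by
  funext n k
  rcases le_or_gt n (θ 0 - 1) with hn | hn
  · rw [boost_of_le hn]
    rcases eq_or_ne k 0 with rfl | hk
    · rw [thresholdPolicy_zero, Function.update_self, Pi.single_eq_same]
      split_ifs with h
      · rfl
      · simp [show n = 0 by omega]
    · have := hθ (Fin.zero_le k)
      rw [thresholdPolicy_eq, Function.update_of_ne hk, if_neg (by omega), Pi.single_eq_of_ne hk]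
  · rw [boost_of_lt hn]
    induction k using WellFoundedLT.induction with
    | ind k ih =>
      rw [thresholdPolicy_eq, thresholdPolicy_eq Q (Function.update θ 0 1),
        Finset.sum_congr rfl fun l hl => ih l (Finset.mem_Iio.1 hl)]
      rcases eq_or_ne k 0 with rfl | hk
      · rw [Function.update_self, if_pos (by omega), if_pos (by omega)]
      · rw [Function.update_of_ne hk]

/-- If `θ 0 > 1`, no one is served up to `m = θ 0 - 1`, so `m` is the first state with mass. `boost`
at this `m` is again a threshold policy, hence a legitimate competitor; at other levels it need not
be one. -/
theorem IsOptimalThreshold.zero_eq_one (hQ : Q.Standing) (hS : Q.ScaleEconomies)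
    {θ : Fin K → ℕ} (hopt : Q.IsOptimalThreshold θ) : θ 0 = 1 := by
  obtain ⟨⟨h1, hmono⟩, a, ha, hmin⟩ := hopt
  by_contra hne
  have h2 : 1 < θ 0 := lt_of_le_of_ne (h1 0) (Ne.symm hne)
  set d := Q.thresholdPolicy θ with hdef
  have hd : d ∈ Q.efficientPolicies := thresholdPolicy_mem θ
  obtain ⟨α, hα, hle⟩ := ha.exists_isStationary hQ hd
  set m := θ 0 - 1 with hm
  have hoff : ∀ n ≤ m, d n = 0 := fun n hn => by
    funext k
    have := hmono (Fin.zero_le k)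
    rw [hdef, thresholdPolicy_eq, if_neg (by omega)]
    rfl
  have hzero : ∀ n < m, α n = 0 := fun n hn => by
    have := hα.balance n
    rw [hoff (n + 1) hn] at this
    simpa [serviceRate, hQ.lam_pos.ne'] using this
  have hαm : 0 < α m := by
    -- Above `m` group 0 works, so a zero weight at `m` would spread upward and leave no mass at
    -- all.
    refine (hα.nonneg m).lt_of_ne fun h => ?_
    have hall : ∀ n, m ≤ n → α n = 0 := fun n hn => by
      induction n, hn using Nat.le_induction with
      | base => exact h.symm
      | succ n hn ih =>
        have hb := hα.balance n
        rw [ih, mul_zero] at hb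
        refine (mul_eq_zero.1 hb.symm).resolve_left fun hs => ?_
        have h3 := (Finset.sum_eq_zero_iff_of_nonneg fun k _ =>
          mul_nonneg (Nat.cast_nonneg _) (hQ.mu_pos k).le).1 hs 0 (Finset.mem_univ 0)
        rw [hdef, thresholdPolicy_zero, if_pos (by omega)] at h3
        have h4 : 0 < min (Q.M 0) (n + 1) := lt_min (hQ.M_pos 0) n.succ_pos
        exact (mul_pos (Nat.cast_pos.2 h4) (hQ.mu_pos 0)).ne' h3
    have h0 : α = 0 := funext fun n => (lt_or_ge n m).elim (hzero n) (hall n)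
    have := hα.hasSum_one
    rw [h0] at this
    exact zero_ne_one (hasSum_zero.unique this)
  have hB : HasSum (fun n => α (n + m)) 1 := by
    refine (hasSum_nat_add_iff (f := α) m).2 ?_
    rw [Finset.sum_eq_zero fun n hn => hzero n (Finset.mem_range.1 hn), add_zero]
    exact hα.hasSum_one
  have hC : HasSum (fun n => α (n + m) * Q.reducedCost (n + m) (d (n + m)))
      (∑' n, α n * Q.cost n (d n) - Q.c 0 / Q.mu 0 * Q.lam) := by
    refine (hasSum_nat_add_iff (f := fun n => α n * Q.reducedCost n (d n)) m).2 ?_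
    rw [Finset.sum_eq_zero fun n hn => by rw [hzero n (Finset.mem_range.1 hn), zero_mul],
      add_zero]
    exact hα.hasSum_reducedCost hd
  obtain ⟨a', ha', hcost⟩ := hα.exists_boost_lt hQ hS hd (by omega) hαm hB hC (by rw [mul_one])
  rw [boost_thresholdPolicy hmono h2] at hcost
  refine (ha'.trans_le hle).not_ge (hmin _ ⟨fun k => ?_, fun k l hkl => ?_⟩ a' hcost)
  · rcases eq_or_ne k 0 with rfl | hk
    · simp
    · simpa [hk] using h1 k
  · rcases eq_or_ne k 0 with rfl | hk
    · rw [Function.update_self]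
      rcases eq_or_ne l 0 with rfl | hl
      · simp
      · simpa [hl] using h1 l
    · have hl : l ≠ 0 := fun h => hk (le_antisymm (h ▸ hkl) (Fin.zero_le k))
      simpa [hk, hl] using hmono hkl

end GroupQueue

end

theorem theorem10 {K : ℕ} [NeZero K] (Q : GroupQueue K) (hQ : Q.Standing)
    (hS : Q.ScaleEconomies) :
    -- every optimal threshold vector has first threshold `1`
    (∀ θ : Fin K → ℕ, Q.IsOptimalThreshold θ → θ 0 = 1) ∧
    -- the optimal threshold of group 1 read off from the differences of the optimal potential is `1`
    (∀ (d : GroupQueue.Policy K) (a : ℝ) (g : ℕ → ℝ),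
      Q.IsOptimal d → Q.HasAverageCost d a → Q.IsPotential d a g →
        IsLeast {n : ℕ | 1 ≤ n ∧ Q.c 0 / Q.mu 0 < g n - g (n - 1)} 1) ∧
    -- every optimal policy uses group 1 as much as possible whenever a customer is present
    (∀ d : GroupQueue.Policy K, Q.IsOptimal d → ∀ n : ℕ, 1 ≤ n → d n 0 = min (Q.M 0) n) :=
  ⟨fun _ hθ => hθ.zero_eq_one hQ hS,
    fun _ _ _ hd ha hg => ⟨⟨le_rfl, hd.lt_potential_diff hQ hS ha hg⟩, fun _ hn => hn.1⟩,
    fun _ hd _ hn => hd.group_zero_eq hQ hS hn⟩
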